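/- Work with smooth manifolds over $\mathbb R$ or with complex manifolds (finite-dimensional; objects and resolutions Hausdorff and second countable). A Lie groupoid $\Gamma\rightrightarrows M$ has source $s$, target $t$, and a product $\gamma\gamma'$ defined when $t(\gamma)=s(\gamma')$; a right $\Gamma$-module is a manifold $Z$ with a smooth map $\phi:Z\to M$ and a smooth action $z\cdot\gamma$, defined when $\phi(z)=s(\gamma)$, with $\phi(z\cdot\gamma)=t(\gamma)$. Let $\mathcal S\subset M$ be a nonempty embedded submanifold that is $\Gamma$-stable, i.e. $s(\gamma)\in\mathcal S\iff t(\gamma)\in\mathcal S$. A $\Gamma$-resolution of $\overline{\mathcal S}$ is a right $\Gamma$-module $(Z,\phi)$ such that $\phi^{-1}(\mathcal S)$ is dense in $Z$ and $\phi$ restricts to a diffeomorphism (biholomorphism) $\phi^{-1}(\mathcal S)\to\mathcal S$; two of them coincide if there is an equivariant diffeomorphism (biholomorphism) over $M$ between them. For a Morita equivalence $\mathcal X$ from $\Gamma\rightrightarrows M$ to $\Gamma'\rightrightarrows M'$, given by a bimodule $X$ with anchor maps $p:X\to M$, $p':X\to M'$, write $\underline{\mathcal X}(Z,\phi)$ for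 the right $\Gamma'$-module $(Z\times_M X)/\big((z,x)\sim(z\gamma^{-1},\gamma x)\big)$ with anchor $[z,x]\mapsto p'(x)$, and $\underline{\mathcal X}(\mathcal S)=p'(p^{-1}(\mathcal S))$. Let $(Z,\phi)$ be a $\Gamma$-resolution of $\overline{\mathcal S}$. Let $\widehat\Gamma=(\Gamma\rightrightarrows M)\times(Z\times Z\rightrightarrows Z)$ be the product with the pair groupoid, with objects $M\times Z$, and let $\widehat{\mathcal S}=\mathcal S\times Z$. Let $\mathcal X$ be the bimodule $X=\Gamma\times Z$ with $p(\gamma,z)=s(\gamma)$, $p'(\gamma,z)=(t(\gamma),z)$, $\gamma'\cdot(\gamma,z)=(\gamma'\gamma,z)$ and $(\gamma,z)\cdot(\gamma',(z,z'))=(\gamma\gamma',z')$. Then: 1. $\widehat\Gamma$ is a Lie groupoid, $\mathcal X$ is a Morita equivalence between $\Gamma$ and $\widehat\Gamma$, $\underline{\mathcal X}(\mathcal S)=\widehat{\mathcal S}$ is an embedded $\widehat\Gamma$-stable submanifold, and $\underline{\mathcal X}(Z,\phi)$ is a manifold and coincides with the $\widehat\Gamma$-resolution $(\widehat Z,\widehat\phi)=(Z\times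 Z,\phi\times\mathrm{id})$ of $\overline{\widehat{\mathcal S}}$, on which $(z,z_1)\cdot(\gamma,(z_1,z_2))=(z\cdot\gamma,z_2)$. 2. Let $\widehat L=\{(\phi(z),z):z\in Z\}$. Then $(\widehat Z,\widehat\phi)$ is $\widehat L$-compatible via the diagonal $\Delta\subset Z\times Z$: $\widehat L$ is an embedded submanifold in which $\widehat L\cap\widehat{\mathcal S}$ is dense, $\Delta$ is an embedded submanifold which $\widehat\phi$ maps diffeomorphically (biholomorphically) onto $\widehat L$, and $\Delta$ is transverse to the $\widehat\Gamma$-orbits in $\widehat Z$ and meets all those contained in $\widehat\phi^{-1}(\widehat{\mathcal S})$. 3. Let $\psi:\widehat L\to\Delta$ be the inverse of $\widehat\phi|_\Delta$ and $\widehat R=\{r\in\widehat\Gamma: s(r)\in\widehat L,\ \psi(s(r))\cdot r\in\Delta\}$. Then $\widehat R\rightrightarrows\widehat L$ is a Lie subgroupoid of $\widehat\Gamma$, closed in the set of arrows with source and target in $\widehat L$, and full in $\widehat{\mathcal S}$: $\widehat L\cap\widehat{\mathcal S}$ is dense in $\widehat L$, $\widehat L$ meets all $\widehat\Gamma$-orbits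 contained in $\widehat{\mathcal S}$ and intersects them transversally in $\widehat{\mathcal S}$, and every arrow of $\widehat\Gamma$ between two points of $\widehat L\cap\widehat{\mathcal S}$ lies in $\widehat R$. 4. The quotient $Z(\widehat R)=\widehat R\backslash s^{-1}(\widehat L)$, with $\phi_{\widehat R}[\gamma]=t(\gamma)$ and $[\gamma]\cdot\gamma'=[\gamma\gamma']$, is a manifold and a $\widehat\Gamma$-resolution of $\overline{\widehat{\mathcal S}}$; it coincides with $(\widehat Z,\widehat\phi)$. Moreover, with $\mathcal X^{-1}$ the inverse bimodule, $\underline{\mathcal X^{-1}}(Z(\widehat R),\phi_{\widehat R})$ is a manifold and a $\Gamma$-resolution of $\overline{\mathcal S}$ which coincides with $(Z,\phi)$: $$(Z,\phi)=\underline{\mathcal X}^{-1}\big((Z(\widehat R),\phi_{\widehat R})\big).$$ -/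

import Mathlib

open Set Filter Topology
open scoped Manifold ContDiff

/-! ## Groupoids, modules and bimodules: the algebraic layer

Arrows compose as in `g h` with `tgt g = src h`. The product `mul` and the actions `act` are total
functions; their values carry meaning only on composable pairs, and all laws and all smoothness
conditions are restricted to such pairs. -/

/-- A groupoid with set of arrows `G` and set of objects `M`. -/
structure SetGroupoid (G M : Type*) where
  src : G → M
  tgt : G → M
  unit : M → G
  inv : G → G
  mul : G → G → G
  src_unit : ∀ m, src (unit m) = m
  tgt_unit : ∀ m, tgt (unit m) = m
  src_mul : ∀ g h, tgt g = src h → src (mul g h) = src g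
  tgt_mul : ∀ g h, tgt g = src h → tgt (mul g h) = tgt h
  mul_assoc : ∀ g h k, tgt g = src h → tgt h = src k → mul (mul g h) k = mul g (mul h k)
  unit_mul : ∀ g, mul (unit (src g)) g = g
  mul_unit : ∀ g, mul g (unit (tgt g)) = g
  src_inv : ∀ g, src (inv g) = tgt g
  tgt_inv : ∀ g, tgt (inv g) = src g
  mul_inv : ∀ g, mul g (inv g) = unit (src g)
  inv_mul : ∀ g, mul (inv g) g = unit (tgt g)

namespace SetGroupoid

section Algebra

variable {G M G' M' X Z : Type*}

theorem eq_inv_of_mul (Γ : SetGroupoid G M) {g h : G} (hgh : Γ.tgt g = Γ.src h)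
    (h1 : Γ.mul g h = Γ.unit (Γ.src g)) : h = Γ.inv g := by
  have e1 : Γ.mul (Γ.mul (Γ.inv g) g) h = Γ.mul (Γ.inv g) (Γ.mul g h) :=
    Γ.mul_assoc _ _ _ (Γ.tgt_inv g) hgh
  rw [h1, Γ.inv_mul, hgh, Γ.unit_mul] at e1
  rw [e1, ← Γ.tgt_inv g, Γ.mul_unit]

theorem inv_unit (Γ : SetGroupoid G M) (m : M) : Γ.inv (Γ.unit m) = Γ.unit m := by
  symm
  apply Γ.eq_inv_of_mul
  · rw [Γ.src_unit, Γ.tgt_unit]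
  · have := Γ.unit_mul (Γ.unit m)
    rw [Γ.src_unit] at this ⊢
    exact this

theorem inv_mul_rev (Γ : SetGroupoid G M) {g h : G} (hgh : Γ.tgt g = Γ.src h) :
    Γ.inv (Γ.mul g h) = Γ.mul (Γ.inv h) (Γ.inv g) := by
  have hi : Γ.tgt (Γ.inv h) = Γ.src (Γ.inv g) := by rw [Γ.tgt_inv, Γ.src_inv, hgh]
  symm
  apply Γ.eq_inv_of_mul
  · rw [Γ.tgt_mul _ _ hgh, Γ.src_mul _ _ hi, Γ.src_inv]
  · rw [Γ.mul_assoc _ _ _ hgh (by rw [Γ.src_mul _ _ hi, Γ.src_inv]),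
      ← Γ.mul_assoc h _ _ (Γ.src_inv h).symm hi, Γ.mul_inv, ← hgh, ← Γ.src_inv g, Γ.unit_mul,
      Γ.mul_inv, Γ.src_mul _ _ hgh]

/-- A subset of the objects is stable if it is a union of orbits. -/
def IsStable (Γ : SetGroupoid G M) (S : Set M) : Prop :=
  ∀ g, Γ.tgt g ∈ S ↔ Γ.src g ∈ S

/-- The pair groupoid `Z × Z ⇉ Z`. -/
def pair (Z : Type*) : SetGroupoid (Z × Z) Z where
  src p := p.1
  tgt p := p.2
  unit z := (z, z)
  inv p := (p.2, p.1)
  mul p q := (p.1, q.2)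
  src_unit _ := rfl
  tgt_unit _ := rfl
  src_mul _ _ _ := rfl
  tgt_mul _ _ _ := rfl
  mul_assoc _ _ _ _ _ := rfl
  unit_mul _ := rfl
  mul_unit _ := rfl
  src_inv _ := rfl
  tgt_inv _ := rfl
  mul_inv _ := rfl
  inv_mul _ := rfl

/-- The direct product of two groupoids. -/
def prod (Γ : SetGroupoid G M) (Γ' : SetGroupoid G' M') : SetGroupoid (G × G') (M × M') where
  src g := (Γ.src g.1, Γ'.src g.2)
  tgt g := (Γ.tgt g.1, Γ'.tgt g.2)
  unit m := (Γ.unit m.1, Γ'.unit m.2)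
  inv g := (Γ.inv g.1, Γ'.inv g.2)
  mul g h := (Γ.mul g.1 h.1, Γ'.mul g.2 h.2)
  src_unit m := by simp [src_unit]
  tgt_unit m := by simp [tgt_unit]
  src_mul g h hgh := by
    rw [Prod.mk.injEq] at hgh ⊢
    exact ⟨Γ.src_mul _ _ hgh.1, Γ'.src_mul _ _ hgh.2⟩
  tgt_mul g h hgh := by
    rw [Prod.mk.injEq] at hgh ⊢
    exact ⟨Γ.tgt_mul _ _ hgh.1, Γ'.tgt_mul _ _ hgh.2⟩
  mul_assoc g h k hgh hhk := by
    rw [Prod.mk.injEq] at hgh hhk ⊢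
    exact ⟨Γ.mul_assoc _ _ _ hgh.1 hhk.1, Γ'.mul_assoc _ _ _ hgh.2 hhk.2⟩
  unit_mul g := by simp [unit_mul]
  mul_unit g := by simp [mul_unit]
  src_inv g := by simp [src_inv]
  tgt_inv g := by simp [tgt_inv]
  mul_inv g := by simp [mul_inv]
  inv_mul g := by simp [inv_mul]

/-- A left module: `g · x` makes sense when `tgt g = anchor x`. -/
structure LeftModule (Γ : SetGroupoid G M) (X : Type*) where
  anchor : X → M
  act : G → X → X
  anchor_act : ∀ g x, Γ.tgt g = anchor x → anchor (act g x) = Γ.src g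
  act_unit : ∀ x, act (Γ.unit (anchor x)) x = x
  act_mul : ∀ g h x, Γ.tgt g = Γ.src h → Γ.tgt h = anchor x →
    act (Γ.mul g h) x = act g (act h x)

/-- A right module: `x · g` makes sense when `anchor x = src g`. -/
structure RightModule (Γ : SetGroupoid G M) (X : Type*) where
  anchor : X → M
  act : X → G → X
  anchor_act : ∀ x g, anchor x = Γ.src g → anchor (act x g) = Γ.tgt g
  act_unit : ∀ x, act x (Γ.unit (anchor x)) = x
  act_mul : ∀ x g h, anchor x = Γ.src g → Γ.tgt g = Γ.src h →
    act x (Γ.mul g h) = act (act x g) h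

/-- A bimodule: a left and a right module structure on the same set, each of which preserves the
fibres of the other anchor, and which commute. `left.anchor` is `p`, `right.anchor` is `p'`. -/
structure Bimodule (Γ : SetGroupoid G M) (Γ' : SetGroupoid G' M') (X : Type*) where
  left : LeftModule Γ X
  right : RightModule Γ' X
  right_act_left : ∀ g x, Γ.tgt g = left.anchor x →
    right.anchor (left.act g x) = right.anchor x
  left_act_right : ∀ x g', right.anchor x = Γ'.src g' →
    left.anchor (right.act x g') = left.anchor x
  act_comm : ∀ g x g', Γ.tgt g = left.anchor x → right.anchor x = Γ'.src g' →
    right.act (left.act g x) g' = left.act g (right.act x g')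

namespace Bimodule

variable {Γ : SetGroupoid G M} {Γ' : SetGroupoid G' M'}

/-- The inverse bimodule: the same set, with `g' · x := x · g'⁻¹` and `x · g := g⁻¹ · x`. -/
def inverse (B : Bimodule Γ Γ' X) : Bimodule Γ' Γ X where
  left :=
    { anchor := B.right.anchor
      act := fun g' x => B.right.act x (Γ'.inv g')
      anchor_act := fun g' x h => by
        rw [B.right.anchor_act _ _ (by rw [Γ'.src_inv, h]), Γ'.tgt_inv]
      act_unit := fun x => by rw [Γ'.inv_unit, B.right.act_unit]
      act_mul := fun g h x hgh hx => by
        rw [Γ'.inv_mul_rev hgh]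
        exact B.right.act_mul _ _ _ (by rw [Γ'.src_inv, hx])
          (by rw [Γ'.tgt_inv, Γ'.src_inv, hgh]) }
  right :=
    { anchor := B.left.anchor
      act := fun x g => B.left.act (Γ.inv g) x
      anchor_act := fun x g h => by
        rw [B.left.anchor_act _ _ (by rw [Γ.tgt_inv, h]), Γ.src_inv]
      act_unit := fun x => by rw [Γ.inv_unit, B.left.act_unit]
      act_mul := fun x g h hx hgh => by
        rw [Γ.inv_mul_rev hgh]
        exact B.left.act_mul _ _ _ (by rw [Γ.tgt_inv, Γ.src_inv, hgh])
          (by rw [Γ.tgt_inv, hx]) }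
  right_act_left g' x h := B.left_act_right _ _ (by rw [Γ'.src_inv]; exact h.symm)
  left_act_right x g h := B.right_act_left _ _ (by rw [Γ.tgt_inv]; exact h.symm)
  act_comm g' x g h h' :=
    (B.act_comm _ _ _ (by rw [Γ.tgt_inv]; exact h'.symm) (by rw [Γ'.src_inv]; exact h.symm)).symm

/-- The correspondence of stable subsets `S ↦ p' (p ⁻¹ S)`. -/
def mapStable (B : Bimodule Γ Γ' X) (S : Set M) : Set M' :=
  B.right.anchor '' (B.left.anchor ⁻¹' S)

/-- The fibre product `Z ×_M X`. -/
def fibre (B : Bimodule Γ Γ' X) (N : RightModule Γ Z) : Set (Z × X) :=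
  {q | N.anchor q.1 = B.left.anchor q.2}

/-- The relation `(z, x) ∼ (z · g⁻¹, g · x)` on `Z ×_M X`. -/
def rel (B : Bimodule Γ Γ' X) (N : RightModule Γ Z) (q q' : B.fibre N) : Prop :=
  ∃ g, Γ.tgt g = N.anchor q.1.1 ∧ q'.1 = (N.act q.1.1 (Γ.inv g), B.left.act g q.1.2)

/-- The set `(Z ×_M X) / ∼`. -/
abbrev Induced (B : Bimodule Γ Γ' X) (N : RightModule Γ Z) : Type _ :=
  Quot (B.rel N)

open Classical in
/-- The right `Γ'`-module that corresponds to the right `Γ`-module `N`: the set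
`(Z ×_M X) / ∼` with `[z, x] ↦ p' x` and `[z, x] · g' = [z, x · g']`. -/
noncomputable def induced (B : Bimodule Γ Γ' X) (N : RightModule Γ Z) :
    RightModule Γ' (B.Induced N) where
  anchor := Quot.lift (fun q => B.right.anchor q.1.2) (by
    rintro q q' ⟨g, hg, hq'⟩
    show B.right.anchor q.1.2 = B.right.anchor q'.1.2
    rw [hq']
    exact (B.right_act_left g _ (hg.trans q.2)).symm)
  act w g' := Quot.lift (fun q : B.fibre N =>
      if h : B.right.anchor q.1.2 = Γ'.src g' then
        Quot.mk (B.rel N) ⟨(q.1.1, B.right.act q.1.2 g'),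
          (show N.anchor q.1.1 = _ from q.2).trans (B.left_act_right _ _ h).symm⟩
      else Quot.mk (B.rel N) q) (by
    rintro ⟨⟨z, x⟩, hq⟩ ⟨⟨z', x'⟩, hq'⟩ ⟨g, hg, e⟩
    obtain ⟨rfl, rfl⟩ := Prod.mk.injEq .. ▸ e
    have hgx : Γ.tgt g = B.left.anchor x := Eq.trans hg hq
    have ha := B.right_act_left g x hgx
    by_cases h : B.right.anchor x = Γ'.src g'
    · have h' := ha.trans h
      simp only [h, h', dif_pos]
      apply Quot.sound
      refine ⟨g, hg, ?_⟩
      show (_, B.right.act (B.left.act g x) g') = (_, B.left.act g (B.right.act x g'))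
      rw [B.act_comm g x g' hgx h]
    · have h' : ¬ B.right.anchor (B.left.act g x) = Γ'.src g' := fun h' => h (ha.symm.trans h')
      simp only [h, h', dif_neg, not_false_eq_true]
      exact Quot.sound ⟨g, hg, rfl⟩) w
  anchor_act := by
    rintro ⟨q⟩ g' h
    have h1 : B.right.anchor q.1.2 = Γ'.src g' := h
    simp only [h1, dif_pos]
    exact B.right.anchor_act _ _ h1
  act_unit := by
    rintro ⟨q⟩
    have h1 : B.right.anchor q.1.2 = Γ'.src (Γ'.unit (B.right.anchor q.1.2)) :=
      (Γ'.src_unit _).symm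
    simp only [← h1, dif_pos, B.right.act_unit]
  act_mul := by
    rintro ⟨q⟩ g h hg hgh
    have h1 : B.right.anchor q.1.2 = Γ'.src g := hg
    have h2 : B.right.anchor q.1.2 = Γ'.src (Γ'.mul g h) := by rw [h1, Γ'.src_mul _ _ hgh]
    have h3 : B.right.anchor (B.right.act q.1.2 g) = Γ'.src h := by
      rw [B.right.anchor_act _ _ h1, hgh]
    simp only [h1, h2.symm.trans h1, h3, dif_pos]
    congr 3
    exact B.right.act_mul _ _ _ h1 hgh

end Bimodule

/-- For subsets `R` of the arrows and `L` of the objects: the relation `γ ∼ r γ`, `r ∈ R`, on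
`Γ_L = src ⁻¹ L`. -/
def subRel (Γ : SetGroupoid G M) (R : Set G) (L : Set M) (a b : Γ.src ⁻¹' L) : Prop :=
  ∃ r ∈ R, Γ.tgt r = Γ.src a.1 ∧ b.1 = Γ.mul r a.1

/-- The set `Z(R) = R \ Γ_L`. -/
abbrev ZQuot (Γ : SetGroupoid G M) (R : Set G) (L : Set M) : Type _ :=
  Quot (Γ.subRel R L)

open Classical in
/-- The right module `(Z(R), φ_R)`: `φ_R [γ] = tgt γ` and `[γ] · g = [γ g]`. -/
noncomputable def ZModule (Γ : SetGroupoid G M) (R : Set G) (L : Set M) :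
    RightModule Γ (Γ.ZQuot R L) where
  anchor := Quot.lift (fun a => Γ.tgt a.1) (by
    rintro a b ⟨r, -, hr, hb⟩
    show Γ.tgt a.1 = Γ.tgt b.1
    rw [hb, Γ.tgt_mul _ _ hr])
  act w g := Quot.lift (fun a : Γ.src ⁻¹' L =>
      if h : Γ.tgt a.1 = Γ.src g then
        Quot.mk (Γ.subRel R L) ⟨Γ.mul a.1 g, by
          rw [mem_preimage, Γ.src_mul _ _ h]; exact a.2⟩
      else Quot.mk (Γ.subRel R L) a) (by
    rintro ⟨a, ha⟩ ⟨b, hb⟩ ⟨r, hrR, hr, hab⟩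
    obtain rfl : b = Γ.mul r a := hab
    have ht := Γ.tgt_mul r a hr
    by_cases h : Γ.tgt a = Γ.src g
    · have h' := ht.trans h
      simp only [h, h', dif_pos]
      apply Quot.sound
      refine ⟨r, hrR, ?_, ?_⟩
      · rw [Γ.src_mul _ _ h, hr]
      · exact Γ.mul_assoc _ _ _ hr h
    · have h' : ¬ Γ.tgt (Γ.mul r a) = Γ.src g := fun h' => h (ht.symm.trans h')
      simp only [h, h', dif_neg, not_false_eq_true]
      exact Quot.sound ⟨r, hrR, hr, rfl⟩) w
  anchor_act := by
    rintro ⟨a⟩ g h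
    have h1 : Γ.tgt a.1 = Γ.src g := h
    simp only [h1, dif_pos]
    exact Γ.tgt_mul _ _ h1
  act_unit := by
    rintro ⟨a⟩
    have h1 : Γ.tgt a.1 = Γ.src (Γ.unit (Γ.tgt a.1)) := (Γ.src_unit _).symm
    simp only [← h1, dif_pos, Γ.mul_unit]
  act_mul := by
    rintro ⟨a⟩ g h hg hgh
    have h1 : Γ.tgt a.1 = Γ.src g := hg
    have h2 : Γ.src (Γ.mul g h) = Γ.src g := Γ.src_mul _ _ hgh
    have h3 : Γ.tgt (Γ.mul a.1 g) = Γ.src h := by rw [Γ.tgt_mul _ _ h1, hgh]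
    simp only [h1, h2, h3, dif_pos]
    congr 2
    exact (Γ.mul_assoc _ _ _ h1 hgh).symm

/-- The natural bimodule between `Γ` and `Γ × (Z × Z ⇉ Z)`: the set `Γ × Z` with
`p (γ, z) = src γ`, `p' (γ, z) = (tgt γ, z)`, `g · (γ, z) = (g γ, z)` and
`(γ, z) · (g, (z, z')) = (γ g, z')`. -/
def naturalBimodule (Γ : SetGroupoid G M) (Z : Type*) :
    Bimodule Γ (Γ.prod (pair Z)) (G × Z) where
  left :=
    { anchor := fun x => Γ.src x.1
      act := fun g x => (Γ.mul g x.1, x.2)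
      anchor_act := fun g x h => Γ.src_mul _ _ h
      act_unit := fun x => by simp [Γ.unit_mul]
      act_mul := fun g h x hgh hx => by simp [Γ.mul_assoc _ _ _ hgh hx] }
  right :=
    { anchor := fun x => (Γ.tgt x.1, x.2)
      act := fun x g => (Γ.mul x.1 g.1, g.2.2)
      anchor_act := fun x g h => by
        have h1 : Γ.tgt x.1 = Γ.src g.1 := congrArg Prod.fst h
        simp [prod, pair, Γ.tgt_mul _ _ h1]
      act_unit := fun x => by simp [prod, pair, Γ.mul_unit]
      act_mul := fun x g h hx hgh => by
        have h1 : Γ.tgt x.1 = Γ.src g.1 := congrArg Prod.fst hx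
        have h2 : Γ.tgt g.1 = Γ.src h.1 := congrArg Prod.fst hgh
        simp [prod, pair, Γ.mul_assoc _ _ _ h1 h2] }
  right_act_left g x h := by simp [Γ.tgt_mul _ _ h]
  left_act_right x g h := Γ.src_mul _ _ (congrArg Prod.fst h)
  act_comm g x g' h h' := by
    have h1 : Γ.tgt x.1 = Γ.src g'.1 := congrArg Prod.fst h'
    simp [Γ.mul_assoc _ _ _ h h1]

/-- For a right `Γ`-module `(Z, φ)`: the right `Γ × (Z × Z ⇉ Z)`-module `(Z × Z, φ × id)` with
`(z, z₁) · (g, (z₁, z₂)) = (z · g, z₂)`. -/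
def RightModule.hat {Γ : SetGroupoid G M} (N : RightModule Γ Z) :
    RightModule (Γ.prod (pair Z)) (Z × Z) where
  anchor w := (N.anchor w.1, w.2)
  act w g := (N.act w.1 g.1, g.2.2)
  anchor_act w g h := by
    have h1 : N.anchor w.1 = Γ.src g.1 := congrArg Prod.fst h
    simp [prod, pair, N.anchor_act _ _ h1]
  act_unit w := by simp [prod, pair, N.act_unit]
  act_mul w g h hw hgh := by
    have h1 : N.anchor w.1 = Γ.src g.1 := congrArg Prod.fst hw
    have h2 : Γ.tgt g.1 = Γ.src h.1 := congrArg Prod.fst hgh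
    simp [prod, pair, N.act_mul _ _ _ h1 h2]

/-- For a right module `(Z, φ)` and a subset `Lt` of `Z` that `φ` maps bijectively onto `L`, with
inverse `ψ`: the set of all arrows `r` with `src r ∈ L` and `ψ (src r) · r ∈ Lt`. -/
def RightModule.arrowsOf {Γ : SetGroupoid G M} (N : RightModule Γ Z) (Lt : Set Z) : Set G :=
  {r | ∃ z ∈ Lt, N.anchor z = Γ.src r ∧ N.act z r ∈ Lt}

end Algebra

end SetGroupoid

/-! ## Submanifolds, as subsets

`𝕜` is `ℝ` or `ℂ`; manifolds are finite-dimensional and without boundary, and `C^∞` over `ℂ`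
means holomorphic. On an embedded submanifold `A`, `ContMDiffOn I J ∞ f A` says precisely
that the restriction of `f` to `A` is smooth. -/

section Submanifolds

variable {𝕜 : Type*} [RCLike 𝕜]
  {E H X : Type*} [NormedAddCommGroup E] [NormedSpace 𝕜 E] [TopologicalSpace H]
  [TopologicalSpace X] [ChartedSpace H X]
  {E' H' Y : Type*} [NormedAddCommGroup E'] [NormedSpace 𝕜 E'] [TopologicalSpace H']
  [TopologicalSpace Y] [ChartedSpace H' Y]

/-- `A` is an embedded submanifold (of some codimension `c`): locally the zero set of a submersion
to `𝕜 ^ c`. -/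
def IsEmbeddedSubmanifold (I : ModelWithCorners 𝕜 E H) (A : Set X) : Prop :=
  ∃ c : ℕ, ∀ x ∈ A, ∃ U : Set X, IsOpen U ∧ x ∈ U ∧ ∃ f : X → (Fin c → 𝕜),
    ContMDiffOn I 𝓘(𝕜, Fin c → 𝕜) ∞ f U ∧
    (∀ y ∈ U, Function.Surjective (mfderiv I 𝓘(𝕜, Fin c → 𝕜) f y)) ∧
    ∀ y ∈ U, y ∈ A ↔ f y = 0

/-- The tangent space at `x` of an embedded submanifold `A`: the velocities of all smooth paths in
`A` that start at `x`. -/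
def tangentVectors (I : ModelWithCorners 𝕜 E H) (A : Set X) (x : X) : Set (TangentSpace I x) :=
  {v | ∃ c : 𝕜 → X, c 0 = x ∧ ContMDiffAt 𝓘(𝕜, 𝕜) I ∞ c 0 ∧ (∀ᶠ τ in 𝓝 (0 : 𝕜), c τ ∈ A) ∧
    mfderiv 𝓘(𝕜, 𝕜) I c 0 (1 : 𝕜) = v}

/-- `f` restricts to a diffeomorphism (a biholomorphism) from `A` onto `B`. -/
def IsDiffeoOn (I : ModelWithCorners 𝕜 E H) (J : ModelWithCorners 𝕜 E' H') (f : X → Y)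
    (A : Set X) (B : Set Y) : Prop :=
  BijOn f A B ∧ ContMDiffOn I J ∞ f A ∧
    ∀ g : Y → X, LeftInvOn g f A → ContMDiffOn J I ∞ g B

/-- The quotient of the submanifold `P` of `X` by a relation, with the quotient topology and a
given atlas, is a (Hausdorff, second countable) manifold such that the projection is a
submersion: smooth, with smooth local sections through all points of `P`. These conditions
determine the manifold structure of the quotient. -/
structure IsQuotientManifold (I : ModelWithCorners 𝕜 E H) (J : ModelWithCorners 𝕜 E' H')
    (P : Set X) (r : P → P → Prop) [ChartedSpace H' (Quot r)] : Prop where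
  isManifold : IsManifold J ∞ (Quot r)
  t2 : T2Space (Quot r)
  secondCountable : SecondCountableTopology (Quot r)
  smooth : ∀ x : P, ∃ U : Set X, IsOpen U ∧ x.1 ∈ U ∧ ∃ f : X → Quot r,
    ContMDiffOn I J ∞ f U ∧ ∀ y : P, y.1 ∈ U → f y.1 = Quot.mk r y
  sections : ∀ x : P, ∃ V : Set (Quot r), IsOpen V ∧ Quot.mk r x ∈ V ∧ ∃ σ : Quot r → X,
    ContMDiffOn J I ∞ σ V ∧ σ (Quot.mk r x) = x.1 ∧
      ∀ w ∈ V, ∃ h : σ w ∈ P, Quot.mk r ⟨σ w, h⟩ = w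

/-- `(Z, φ)` is a resolution of the closure of the embedded submanifold `S`. -/
def IsResolution (I : ModelWithCorners 𝕜 E H) (J : ModelWithCorners 𝕜 E' H') (S : Set Y)
    (φ : X → Y) : Prop :=
  ContMDiff I J ∞ φ ∧ Dense (φ ⁻¹' S) ∧ IsDiffeoOn I J φ (φ ⁻¹' S) S

end Submanifolds

/-! ## Lie groupoids, equivariant resolutions, Morita equivalences, Lie subgroupoids -/

namespace SetGroupoid

section Smooth

variable {𝕜 : Type*} [RCLike 𝕜]
  {E₁ H₁ G : Type*} [NormedAddCommGroup E₁] [NormedSpace 𝕜 E₁] [TopologicalSpace H₁]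
  [TopologicalSpace G] [ChartedSpace H₁ G]
  {E₂ H₂ M : Type*} [NormedAddCommGroup E₂] [NormedSpace 𝕜 E₂] [TopologicalSpace H₂]
  [TopologicalSpace M] [ChartedSpace H₂ M]
  {E₃ H₃ Z : Type*} [NormedAddCommGroup E₃] [NormedSpace 𝕜 E₃] [TopologicalSpace H₃]
  [TopologicalSpace Z] [ChartedSpace H₃ Z]
  {E₄ H₄ G' : Type*} [NormedAddCommGroup E₄] [NormedSpace 𝕜 E₄] [TopologicalSpace H₄]
  [TopologicalSpace G'] [ChartedSpace H₄ G']
  {E₅ H₅ M' : Type*} [NormedAddCommGroup E₅] [NormedSpace 𝕜 E₅] [TopologicalSpace H₅]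
  [TopologicalSpace M'] [ChartedSpace H₅ M']

/-- `Γ ⇉ M` is a Lie groupoid for the given manifold structures on arrows and objects. -/
structure IsLie (Γ : SetGroupoid G M) (I : ModelWithCorners 𝕜 E₁ H₁)
    (J : ModelWithCorners 𝕜 E₂ H₂) : Prop where
  src : Manifold.IsSubmersion I J ∞ Γ.src
  tgt : Manifold.IsSubmersion I J ∞ Γ.tgt
  unit : ContMDiff J I ∞ Γ.unit
  inv : ContMDiff I I ∞ Γ.inv
  mul : ContMDiffOn (I.prod I) I ∞ (fun q : G × G => Γ.mul q.1 q.2)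
    {q | Γ.tgt q.1 = Γ.src q.2}

/-- The tangent space at `m` of the orbit through `m`: velocities at `m` of the paths
`τ ↦ tgt (c τ)`, for paths of arrows `c` with source `m` that start at the unit. -/
def orbitTangent (Γ : SetGroupoid G M) (I : ModelWithCorners 𝕜 E₁ H₁)
    (J : ModelWithCorners 𝕜 E₂ H₂) (m : M) : Set (TangentSpace J m) :=
  {v | ∃ c : 𝕜 → G, c 0 = Γ.unit m ∧ ContMDiffAt 𝓘(𝕜, 𝕜) I ∞ c 0 ∧
    (∀ᶠ τ in 𝓝 (0 : 𝕜), Γ.src (c τ) = m) ∧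
    mfderiv 𝓘(𝕜, 𝕜) J (fun τ => Γ.tgt (c τ)) 0 (1 : 𝕜) = v}

/-- The left action is smooth. -/
structure LeftModule.IsSmooth {Γ : SetGroupoid G M} (N : LeftModule Γ Z)
    (I : ModelWithCorners 𝕜 E₁ H₁) (J : ModelWithCorners 𝕜 E₂ H₂)
    (K : ModelWithCorners 𝕜 E₃ H₃) : Prop where
  anchor : ContMDiff K J ∞ N.anchor
  act : ContMDiffOn (I.prod K) K ∞ (fun q : G × Z => N.act q.1 q.2)
    {q | Γ.tgt q.1 = N.anchor q.2}

/-- The right action is smooth. -/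
structure RightModule.IsSmooth {Γ : SetGroupoid G M} (N : RightModule Γ Z)
    (I : ModelWithCorners 𝕜 E₁ H₁) (J : ModelWithCorners 𝕜 E₂ H₂)
    (K : ModelWithCorners 𝕜 E₃ H₃) : Prop where
  anchor : ContMDiff K J ∞ N.anchor
  act : ContMDiffOn (K.prod I) K ∞ (fun q : Z × G => N.act q.1 q.2)
    {q | N.anchor q.1 = Γ.src q.2}

/-- The tangent space at `z` of the `Γ`-orbit through `z` in a right module. -/
def RightModule.orbitTangent {Γ : SetGroupoid G M} (N : RightModule Γ Z)
    (I : ModelWithCorners 𝕜 E₁ H₁) (K : ModelWithCorners 𝕜 E₃ H₃) (z : Z) :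
    Set (TangentSpace K z) :=
  {v | ∃ c : 𝕜 → G, c 0 = Γ.unit (N.anchor z) ∧ ContMDiffAt 𝓘(𝕜, 𝕜) I ∞ c 0 ∧
    (∀ᶠ τ in 𝓝 (0 : 𝕜), Γ.src (c τ) = N.anchor z) ∧
    mfderiv 𝓘(𝕜, 𝕜) K (fun τ => N.act z (c τ)) 0 (1 : 𝕜) = v}

/-- `(Z, φ)`, with the given right action, is a `Γ`-resolution of the closure of `S`. -/
def RightModule.IsEquivariantResolution {Γ : SetGroupoid G M} (N : RightModule Γ Z)
    (I : ModelWithCorners 𝕜 E₁ H₁) (J : ModelWithCorners 𝕜 E₂ H₂)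
    (K : ModelWithCorners 𝕜 E₃ H₃) (S : Set M) : Prop :=
  N.IsSmooth I J K ∧ IsResolution K J S N.anchor

/-- Two right modules (in particular two `Γ`-resolutions) coincide: there is an equivariant
diffeomorphism over `M` between them. -/
def RightModule.Coincide {Γ : SetGroupoid G M} (N : RightModule Γ Z)
    (K : ModelWithCorners 𝕜 E₃ H₃) {E₆ H₆ W : Type*} [NormedAddCommGroup E₆] [NormedSpace 𝕜 E₆]
    [TopologicalSpace H₆] [TopologicalSpace W] [ChartedSpace H₆ W] (N' : RightModule Γ W)
    (K' : ModelWithCorners 𝕜 E₆ H₆) : Prop :=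
  ∃ Φ : Diffeomorph K K' Z W ∞, (∀ z, N'.anchor (Φ z) = N.anchor z) ∧
    ∀ z g, N.anchor z = Γ.src g → Φ (N.act z g) = N'.act (Φ z) g

/-- The bimodule `B` is a Morita equivalence of Lie groupoids. -/
structure Bimodule.IsMorita {Γ : SetGroupoid G M} {Γ' : SetGroupoid G' M'} (B : Bimodule Γ Γ' Z)
    (I : ModelWithCorners 𝕜 E₁ H₁) (J : ModelWithCorners 𝕜 E₂ H₂) (I' : ModelWithCorners 𝕜 E₄ H₄)
    (J' : ModelWithCorners 𝕜 E₅ H₅) (K : ModelWithCorners 𝕜 E₃ H₃) : Prop where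
  smooth_left : B.left.IsSmooth I J K
  smooth_right : B.right.IsSmooth I' J' K
  surjective_left : Function.Surjective B.left.anchor
  submersion_left : Manifold.IsSubmersion K J ∞ B.left.anchor
  surjective_right : Function.Surjective B.right.anchor
  submersion_right : Manifold.IsSubmersion K J' ∞ B.right.anchor
  free_left : ∀ g h x, Γ.tgt g = B.left.anchor x → Γ.tgt h = B.left.anchor x →
    B.left.act g x = B.left.act h x → g = h
  free_right : ∀ x g h, B.right.anchor x = Γ'.src g → B.right.anchor x = Γ'.src h →
    B.right.act x g = B.right.act x h → g = h
  transitive_left : ∀ x y, B.right.anchor x = B.right.anchor y →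
    ∃ g, Γ.tgt g = B.left.anchor x ∧ B.left.act g x = y
  transitive_right : ∀ x y, B.left.anchor x = B.left.anchor y →
    ∃ g, B.right.anchor x = Γ'.src g ∧ B.right.act x g = y
  proper_left : IsProperMap (fun q : {q : G × Z // Γ.tgt q.1 = B.left.anchor q.2} =>
    (B.left.act q.1.1 q.1.2, q.1.2))
  proper_right : IsProperMap (fun q : {q : Z × G' // B.right.anchor q.1 = Γ'.src q.2} =>
    (q.1.1, B.right.act q.1.1 q.1.2))

/-- `R ⇉ L` is a Lie subgroupoid of `Γ ⇉ M`: `L` and `R` are submanifolds that are stable under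
the structural maps, and the source map of `R` is a submersion onto `L`. -/
structure IsLieSubgroupoid (Γ : SetGroupoid G M) (I : ModelWithCorners 𝕜 E₁ H₁)
    (J : ModelWithCorners 𝕜 E₂ H₂) (R : Set G) (L : Set M) : Prop where
  objects : IsEmbeddedSubmanifold J L
  arrows : IsEmbeddedSubmanifold I R
  src_mem : ∀ r ∈ R, Γ.src r ∈ L
  tgt_mem : ∀ r ∈ R, Γ.tgt r ∈ L
  unit_mem : ∀ m ∈ L, Γ.unit m ∈ R
  inv_mem : ∀ r ∈ R, Γ.inv r ∈ R
  mul_mem : ∀ r ∈ R, ∀ r' ∈ R, Γ.tgt r = Γ.src r' → Γ.mul r r' ∈ R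
  submersion : ∀ r ∈ R, ∀ v ∈ tangentVectors J L (Γ.src r),
    ∃ u ∈ tangentVectors I R r, mfderiv I J Γ.src r u = v

/-- `R` is closed in the set `Γ_L^L` of all arrows with source and target in `L`. -/
def IsClosedIn (Γ : SetGroupoid G M) (R : Set G) (L : Set M) : Prop :=
  ∃ C : Set G, IsClosed C ∧ R = C ∩ (Γ.src ⁻¹' L ∩ Γ.tgt ⁻¹' L)

/-- `R ⇉ L` is a Lie subgroupoid in `S`: `L ∩ S` is dense in `L`, and `L` meets all orbits contained
in `S` and intersects them transversally. -/
structure IsSubgroupoidIn (Γ : SetGroupoid G M) (I : ModelWithCorners 𝕜 E₁ H₁)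
    (J : ModelWithCorners 𝕜 E₂ H₂) (R : Set G) (L S : Set M) : Prop where
  isLieSubgroupoid : Γ.IsLieSubgroupoid I J R L
  dense : L ⊆ closure (L ∩ S)
  transverse : ∀ m ∈ L ∩ S, ∀ v : TangentSpace J m, v ∈ tangentVectors J S m ↔
    ∃ a ∈ Γ.orbitTangent I J m, ∃ b ∈ tangentVectors J L m, v = a + b
  meets : ∀ m ∈ S, ∃ g, Γ.src g = m ∧ Γ.tgt g ∈ L

/-- `R ⇉ L` is a Lie subgroupoid full in `S`: it is in `S`, and an arrow of `Γ` that connects two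
points of `L ∩ S` belongs to `R`. -/
structure IsFullSubgroupoidIn (Γ : SetGroupoid G M) (I : ModelWithCorners 𝕜 E₁ H₁)
    (J : ModelWithCorners 𝕜 E₂ H₂) (R : Set G) (L S : Set M) : Prop where
  isSubgroupoidIn : Γ.IsSubgroupoidIn I J R L S
  full : ∀ g, Γ.src g ∈ L ∩ S → Γ.tgt g ∈ L ∩ S → g ∈ R

/-- The submanifold `Lt` of `Z` exhibits the `Γ`-resolution `(Z, φ)` of the closure of `S` as
`L`-compatible: `L` is a submanifold in which `L ∩ S` is dense, `φ` restricts to a diffeomorphism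
from `Lt` onto `L`, and `Lt` is transverse to the orbits of `Γ` in `Z` and meets all those
contained in `φ ⁻¹ S`. -/
structure RightModule.IsCompatibleVia {Γ : SetGroupoid G M} (N : RightModule Γ Z)
    (I : ModelWithCorners 𝕜 E₁ H₁) (J : ModelWithCorners 𝕜 E₂ H₂)
    (K : ModelWithCorners 𝕜 E₃ H₃) (S L : Set M) (Lt : Set Z) : Prop where
  submanifold : IsEmbeddedSubmanifold J L
  dense : L ⊆ closure (L ∩ S)
  submanifold_lift : IsEmbeddedSubmanifold K Lt
  diffeo : IsDiffeoOn K J N.anchor Lt L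
  transverse : ∀ z ∈ Lt, ∀ v : TangentSpace K z,
    ∃ a ∈ N.orbitTangent I K z, ∃ b ∈ tangentVectors K Lt z, v = a + b
  meets : ∀ z, N.anchor z ∈ S → ∃ g, N.anchor z = Γ.src g ∧ N.act z g ∈ Lt

end Smooth

end SetGroupoid

/-!
Write `Γ × (Z × Z)` for the product of `Γ` with the pair groupoid of `Z`. Its arrows which preserve
the diagonal are the triples `(γ, (z, z · γ))`, so they form the graph of the action map
`(z, γ) ↦ z · γ` on the fibre product `{φ z = src γ}`, which is an embedded submanifold since `src`
is a submersion.

The action map is itself a surjective submersion: local sections `σ` of `tgt` give local sections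
`y ↦ (y · (σ (φ y))⁻¹, σ (φ y))`. Two pairs `(z, γ)` and `(z', γ')` have the same image if and only
if `(z', γ') = (z · g⁻¹, g γ)` for some `g`. Hence each of the three quotients identifies precisely
the points with the same image under a variant of the action map, and a surjective submersion
identifies the quotient by its fibres with its target.

The diagonal is transverse to the orbits because the pair groupoid moves the second coordinate
freely. This transversality passes to the graph of `φ` because the preimage of `S` in a resolution
is open, being locally closed and dense, so that `S` has the image of the full differential of the
resolution as its tangent space.
-/

/-! ## Manifold structures on quotients -/

section Transport

variable {𝕜 : Type*} [RCLike 𝕜]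
  {E H W Q : Type*} [NormedAddCommGroup E] [NormedSpace 𝕜 E] [TopologicalSpace H]
  [TopologicalSpace W] [ChartedSpace H W] [TopologicalSpace Q]

/-- The atlas on `Q` pulled back along a homeomorphism `e : Q ≃ₜ W`. -/
@[reducible]
def pullbackChartedSpace (e : Q ≃ₜ W) (H : Type*) [TopologicalSpace H] [ChartedSpace H W] :
    ChartedSpace H Q :=
  @ChartedSpace.comp H _ W _ Q _ _ (e.toOpenPartialHomeomorph.singletonChartedSpace rfl)

theorem isManifold_pullbackChartedSpace (e : Q ≃ₜ W) (J : ModelWithCorners 𝕜 E H)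
    [IsManifold J ∞ W] : @IsManifold 𝕜 _ E _ _ H _ J ∞ Q _ (pullbackChartedSpace e H) := by
  let _ := pullbackChartedSpace e H
  have : HasGroupoid Q (contDiffGroupoid ∞ J) := ⟨by
    rintro _ _ ⟨_, rfl, c, hc, rfl⟩ ⟨_, rfl, d, hd, rfl⟩
    have transition_eq : (e.toOpenPartialHomeomorph.trans c).symm.trans
        (e.toOpenPartialHomeomorph.trans d) = c.symm.trans d := by
      rw [OpenPartialHomeomorph.trans_symm_eq_symm_trans_symm, OpenPartialHomeomorph.trans_assoc,
        ← OpenPartialHomeomorph.trans_assoc _ _ d, ← Homeomorph.symm_toOpenPartialHomeomorph,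
        ← Homeomorph.trans_toOpenPartialHomeomorph, Homeomorph.symm_trans_self,
        Homeomorph.refl_toOpenPartialHomeomorph, OpenPartialHomeomorph.refl_trans]
    exact transition_eq ▸ (contDiffGroupoid ∞ J).compatible hc hd⟩
  exact .mk' _ _ _

/-- A homeomorphism, as a diffeomorphism for the atlas pulled back along it. -/
def pullbackDiffeomorph (e : Q ≃ₜ W) (J : ModelWithCorners 𝕜 E H) [IsManifold J ∞ W] :
    @Diffeomorph 𝕜 _ E _ _ E _ _ H _ H _ J J Q _ (pullbackChartedSpace e H) W _ _ ∞ :=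
  let _ := pullbackChartedSpace e H
  have := isManifold_pullbackChartedSpace e J
  { toEquiv := e.toEquiv
    contMDiff_toFun := fun q => by
      have chart_symm : ContMDiffAt J J ∞ (chartAt H (e q)).symm (chartAt H q q) :=
        contMDiffOn_chart_symm.contMDiffAt (chart_target_mem_nhds H (e q))
      refine (chart_symm.comp q <|
        contMDiffOn_chart.contMDiffAt (chart_source_mem_nhds H q)).congr_of_eventuallyEq ?_
      filter_upwards [chart_source_mem_nhds H q] with y hy
      exact ((chartAt H (e q)).left_inv hy.2).symm
    contMDiff_invFun := e.surjective.forall.2 fun q => by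
      have chart_symm : ContMDiffAt J J ∞ (chartAt H q).symm (chartAt H (e q) (e q)) :=
        contMDiffOn_chart_symm.contMDiffAt (chart_target_mem_nhds H q)
      refine (chart_symm.comp (e q) <|
        contMDiffOn_chart.contMDiffAt (chart_source_mem_nhds H (e q))).congr_of_eventuallyEq ?_
      filter_upwards [chart_source_mem_nhds H (e q)] with y hy
      exact congrArg e.symm ((chartAt H (e q)).left_inv hy).symm }

end Transport

section Quotient

variable {𝕜 : Type*} [RCLike 𝕜]
  {E H X : Type*} [NormedAddCommGroup E] [NormedSpace 𝕜 E] [TopologicalSpace H]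
  [TopologicalSpace X] [ChartedSpace H X]
  {E' H' W : Type*} [NormedAddCommGroup E'] [NormedSpace 𝕜 E'] [TopologicalSpace H']
  [TopologicalSpace W] [ChartedSpace H' W]
  {E'' H'' Y : Type*} [NormedAddCommGroup E''] [NormedSpace 𝕜 E''] [TopologicalSpace H'']
  [TopologicalSpace Y] [ChartedSpace H'' Y]

/-- `f` is smooth on the subset `A` in the strong sense: near every point of `A` it has a smooth
extension to an open set. -/
def LocallyExtends (I : ModelWithCorners 𝕜 E H) (J : ModelWithCorners 𝕜 E' H') (f : X → W)
    (A : Set X) : Prop :=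
  ∀ x ∈ A, ∃ U : Set X, IsOpen U ∧ x ∈ U ∧ ∃ g : X → W, ContMDiffOn I J ∞ g U ∧ EqOn g f (U ∩ A)

/-- `q` restricts to a surjective submersion from the subset `P` of `X` onto `W`. Submersivity is
encoded by smooth local sections through all points of `P`, so that `P` need not be known to be a
submanifold. -/
structure IsSubmersionOnto (I : ModelWithCorners 𝕜 E H) (J : ModelWithCorners 𝕜 E' H')
    (P : Set X) (q : X → W) : Prop where
  surjOn : SurjOn q P univ
  smooth : LocallyExtends I J q P
  sections : ∀ x ∈ P, ∃ V : Set W, IsOpen V ∧ q x ∈ V ∧ ∃ σ : W → X,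
    ContMDiffOn J I ∞ σ V ∧ σ (q x) = x ∧ ∀ w ∈ V, σ w ∈ P ∧ q (σ w) = w

namespace IsSubmersionOnto

variable {I : ModelWithCorners 𝕜 E H} {J : ModelWithCorners 𝕜 E' H'}
  {K : ModelWithCorners 𝕜 E'' H''} {P : Set X} {q : X → W}

theorem continuousOn (hq : IsSubmersionOnto I J P q) : ContinuousOn q P := fun x hx => by
  obtain ⟨U, hU, hxU, f, hf, hfq⟩ := hq.smooth x hx
  refine (hf.continuousOn.continuousAt (hU.mem_nhds hxU)).continuousWithinAt
    |>.congr_of_eventuallyEq ?_ (hfq ⟨hxU, hx⟩).symm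
  filter_upwards [mem_nhdsWithin_of_mem_nhds (hU.mem_nhds hxU), self_mem_nhdsWithin] with y hyU hyP
  exact (hfq ⟨hyU, hyP⟩).symm

/-- The bijection of the quotient of `P` by the fibres of `q` with `W`. -/
noncomputable def quotEquiv (hq : IsSubmersionOnto I J P q) {r : P → P → Prop}
    (hr : ∀ a b, r a b ↔ q a = q b) : Quot r ≃ W :=
  .ofBijective (Quot.lift (fun x : P => q x) fun a b => (hr a b).1) ⟨by
    rintro ⟨a⟩ ⟨b⟩ hab
    exact Quot.sound ((hr a b).2 hab), fun w => by
    obtain ⟨x, hx, rfl⟩ := hq.surjOn (mem_univ w)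
    exact ⟨Quot.mk r ⟨x, hx⟩, rfl⟩⟩

/-- The bijection `quotEquiv` as a homeomorphism, for the quotient topology. -/
noncomputable def quotHomeomorph (hq : IsSubmersionOnto I J P q) {r : P → P → Prop}
    (hr : ∀ a b, r a b ↔ q a = q b) : Quot r ≃ₜ W where
  toEquiv := hq.quotEquiv hr
  continuous_toFun :=
    continuous_quot_lift _ (continuousOn_iff_continuous_domRestrict.1 hq.continuousOn)
  continuous_invFun := continuous_iff_continuousAt.2 fun w => by
    obtain ⟨x, hx, rfl⟩ := hq.surjOn (mem_univ w)
    obtain ⟨V, hV, hxV, σ, hσ, -, hσq⟩ := hq.sections x hx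
    have continuous_section : Continuous fun w : V => (⟨σ w, (hσq w w.2).1⟩ : P) :=
      (continuousOn_iff_continuous_domRestrict.1 hσ.continuousOn).subtype_mk _
    refine (continuousOn_iff_continuous_domRestrict.2 ?_).continuousAt (hV.mem_nhds hxV)
    refine (continuous_quot_mk.comp continuous_section).congr fun w => ?_
    exact (hq.quotEquiv hr).eq_symm_apply.2 (hσq w w.2).2

theorem exists_isQuotientManifold [IsManifold J ∞ W] [T2Space W] [SecondCountableTopology W]
    (hq : IsSubmersionOnto I J P q) {r : P → P → Prop} (hr : ∀ a b, r a b ↔ q a = q b) :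
    ∃ _ : ChartedSpace H' (Quot r), IsQuotientManifold I J P r ∧
      ∃ Φ : Diffeomorph J J (Quot r) W ∞, ∀ x, Φ (Quot.mk r x) = q x := by
  let e := hq.quotHomeomorph hr
  let _ := pullbackChartedSpace e H'
  let Φ := pullbackDiffeomorph e J
  have symm_apply (x : P) : Φ.symm (q x) = Quot.mk r x := e.symm_apply_apply (Quot.mk r x)
  refine ⟨_, ⟨isManifold_pullbackChartedSpace e J, e.isEmbedding.t2Space,
    e.isEmbedding.secondCountableTopology, fun x => ?_, fun x => ?_⟩, Φ, fun x => rfl⟩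
  · obtain ⟨U, hU, hxU, f, hf, hfq⟩ := hq.smooth x x.2
    refine ⟨U, hU, hxU, Φ.symm ∘ f, Φ.symm.contMDiff.comp_contMDiffOn hf, fun y hy => ?_⟩
    rw [Function.comp_apply, hfq ⟨hy, y.2⟩, symm_apply]
  · obtain ⟨V, hV, hxV, σ, hσ, hσx, hσq⟩ := hq.sections x x.2
    refine ⟨e ⁻¹' V, hV.preimage e.continuous, hxV, σ ∘ Φ,
      hσ.comp Φ.contMDiff.contMDiffOn fun w hw => hw, hσx, fun w hw => ?_⟩
    obtain ⟨hP, hqw⟩ := hσq (e w) hw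
    exact ⟨hP, e.injective hqw⟩

theorem comp_diffeomorph (hq : IsSubmersionOnto I J P q) (e : Diffeomorph K I Y X ∞) :
    IsSubmersionOnto K J (e ⁻¹' P) (q ∘ e) where
  surjOn w _ := by
    obtain ⟨x, hx, rfl⟩ := hq.surjOn (mem_univ w)
    exact ⟨e.symm x, by simpa using hx, by simp⟩
  smooth y hy := by
    obtain ⟨U, hU, hyU, f, hf, hfq⟩ := hq.smooth (e y) hy
    exact ⟨e ⁻¹' U, hU.preimage e.continuous, hyU, f ∘ e,
      hf.comp e.contMDiff.contMDiffOn fun _ hz => hz, fun z hz => hfq hz⟩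
  sections y hy := by
    obtain ⟨V, hV, hyV, σ, hσ, hσy, hσq⟩ := hq.sections (e y) hy
    exact ⟨V, hV, hyV, e.symm ∘ σ, e.symm.contMDiff.comp_contMDiffOn hσ, by simp [hσy],
      fun w hw => by simpa using hσq w hw⟩

theorem prodMap_id (hq : IsSubmersionOnto I J P q) :
    IsSubmersionOnto (I.prod K) (J.prod K) (P ×ˢ univ) (Prod.map q (id : Y → Y)) where
  surjOn := by
    rintro ⟨w, y⟩ -
    obtain ⟨x, hx, rfl⟩ := hq.surjOn (mem_univ w)
    exact ⟨(x, y), ⟨hx, mem_univ y⟩, rfl⟩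
  smooth := by
    rintro ⟨x, y⟩ ⟨hx, -⟩
    obtain ⟨U, hU, hxU, f, hf, hfq⟩ := hq.smooth x hx
    exact ⟨U ×ˢ univ, hU.prod isOpen_univ, ⟨hxU, mem_univ y⟩, Prod.map f id,
      hf.prodMap contMDiffOn_id, fun p hp => Prod.ext (hfq ⟨hp.1.1, hp.2.1⟩) rfl⟩
  sections := by
    rintro ⟨x, y⟩ ⟨hx, -⟩
    obtain ⟨V, hV, hxV, σ, hσ, hσx, hσq⟩ := hq.sections x hx
    exact ⟨V ×ˢ univ, hV.prod isOpen_univ, ⟨hxV, mem_univ y⟩, Prod.map σ id,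
      hσ.prodMap contMDiffOn_id, Prod.ext hσx rfl,
      fun p hp => ⟨⟨(hσq p.1 hp.1).1, mem_univ _⟩, Prod.ext (hσq p.1 hp.1).2 rfl⟩⟩

theorem comp_fst (hq : IsSubmersionOnto I J P q) {D : Set Y} (hD : Nonempty W → D.Nonempty) :
    IsSubmersionOnto (I.prod K) J (P ×ˢ D) (fun p : X × Y => q p.1) where
  surjOn w _ := by
    obtain ⟨x, hx, rfl⟩ := hq.surjOn (mem_univ w)
    obtain ⟨y, hy⟩ := hD ⟨q x⟩
    exact ⟨(x, y), ⟨hx, hy⟩, rfl⟩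
  smooth := by
    rintro ⟨x, y⟩ ⟨hx, -⟩
    obtain ⟨U, hU, hxU, f, hf, hfq⟩ := hq.smooth x hx
    exact ⟨U ×ˢ univ, hU.prod isOpen_univ, ⟨hxU, mem_univ y⟩, f ∘ Prod.fst,
      hf.comp contMDiff_fst.contMDiffOn fun p hp => hp.1, fun p hp => hfq ⟨hp.1.1, hp.2.1⟩⟩
  sections := by
    rintro ⟨x, y⟩ ⟨hx, hy⟩
    obtain ⟨V, hV, hxV, σ, hσ, hσx, hσq⟩ := hq.sections x hx
    exact ⟨V, hV, hxV, fun w => (σ w, y), hσ.prodMk contMDiffOn_const, Prod.ext hσx rfl,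
      fun w hw => ⟨⟨(hσq w hw).1, hy⟩, (hσq w hw).2⟩⟩

end IsSubmersionOnto

end Quotient

/-! ## Submersions -/

section Submersion

variable {𝕜 : Type*} [RCLike 𝕜]
  {E H X : Type*} [NormedAddCommGroup E] [NormedSpace 𝕜 E] [TopologicalSpace H]
  [TopologicalSpace X] [ChartedSpace H X]
  {E' H' Y : Type*} [NormedAddCommGroup E'] [NormedSpace 𝕜 E'] [TopologicalSpace H']
  [TopologicalSpace Y] [ChartedSpace H' Y]
  {E'' H'' Z : Type*} [NormedAddCommGroup E''] [NormedSpace 𝕜 E''] [TopologicalSpace H'']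
  [TopologicalSpace Z] [ChartedSpace H'' Z]
  {I : ModelWithCorners 𝕜 E H} {J : ModelWithCorners 𝕜 E' H'} {K : ModelWithCorners 𝕜 E'' H''}

section Retraction

variable {f : X → Y} {x₀ : X}

/-- In coordinates in which the submersion `f` is a linear projection: the point of the fibre over
`y` that has the same vertical component as `x`. -/
noncomputable def fibreCoord (hf : Manifold.IsSubmersionAt I J ∞ f x₀) (p : Y × X) : E :=
  hf.equiv.symm (hf.codChart.extend J p.1, (hf.equiv (hf.domChart.extend I p.2)).2)

/-- The point `fibreCoord hf (y, x)`, read in `X`. For fixed `y` this is a local retraction onto the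
fibre `f ⁻¹ y`. -/
noncomputable def fibreRetraction (hf : Manifold.IsSubmersionAt I J ∞ f x₀) (p : Y × X) : X :=
  (hf.domChart.extend I).symm (fibreCoord hf p)

/-- The set on which `fibreRetraction` is given by charts. -/
def retractionDomain (hf : Manifold.IsSubmersionAt I J ∞ f x₀) : Set (Y × X) :=
  (hf.codChart.source ×ˢ hf.domChart.source) ∩ fibreCoord hf ⁻¹' (hf.domChart.extend I).target

variable (hf : Manifold.IsSubmersionAt I J ∞ f x₀)

theorem extend_codChart_apply {x : X} (hx : x ∈ hf.domChart.source) :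
    hf.codChart.extend J (f x) = (hf.equiv (hf.domChart.extend I x)).1 := by
  have hx' : x ∈ (hf.domChart.extend I).source := by rwa [hf.domChart.extend_source]
  simpa only [Function.comp_apply, PartialEquiv.left_inv _ hx'] using
    hf.writtenInCharts ((hf.domChart.extend I).map_source hx')

theorem fibreCoord_self {x : X} (hx : x ∈ hf.domChart.source) :
    fibreCoord hf (f x, x) = hf.domChart.extend I x := by
  rw [fibreCoord, extend_codChart_apply hf hx, Prod.mk.eta,
    ContinuousLinearEquiv.symm_apply_apply]

theorem fibreRetraction_self {x : X} (hx : (f x, x) ∈ retractionDomain hf) :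
    fibreRetraction hf (f x, x) = x := by
  rw [fibreRetraction, fibreCoord_self hf hx.1.2]
  exact PartialEquiv.left_inv _ (by rw [hf.domChart.extend_source]; exact hx.1.2)

theorem apply_fibreRetraction {p : Y × X} (hp : p ∈ retractionDomain hf) :
    f (fibreRetraction hf p) = p.1 := by
  have hsource : fibreRetraction hf p ∈ hf.domChart.source := by
    rw [← hf.domChart.extend_source (I := I)]
    exact PartialEquiv.map_target _ hp.2
  have coord_eq : hf.codChart.extend J (f (fibreRetraction hf p)) = hf.codChart.extend J p.1 := by
    rw [extend_codChart_apply hf hsource, fibreRetraction, PartialEquiv.right_inv _ hp.2,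
      fibreCoord, ContinuousLinearEquiv.apply_symm_apply]
  refine (hf.codChart.extend J).injOn ?_ ?_ coord_eq <;> rw [hf.codChart.extend_source]
  exacts [hf.source_subset_preimage_source hsource, hp.1.1]

theorem mem_retractionDomain_self : (f x₀, x₀) ∈ retractionDomain hf := by
  refine ⟨⟨hf.mem_codChart_source, hf.mem_domChart_source⟩, ?_⟩
  rw [mem_preimage, fibreCoord_self hf hf.mem_domChart_source]
  exact PartialEquiv.map_source _ (by rw [hf.domChart.extend_source]; exact hf.mem_domChart_source)

theorem contMDiffOn_fibreCoord :
    ContMDiffOn (J.prod I) 𝓘(𝕜, E) ∞ (fibreCoord hf)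
      (hf.codChart.source ×ˢ hf.domChart.source) := by
  have base : ContMDiffOn (J.prod I) 𝓘(𝕜, E') ∞ (fun p : Y × X => hf.codChart.extend J p.1)
      (hf.codChart.source ×ˢ hf.domChart.source) :=
    (OpenPartialHomeomorph.contMDiffOn_extend hf.codChart_mem_maximalAtlas).comp
      contMDiff_fst.contMDiffOn fun p hp => hp.1
  have point : ContMDiffOn (J.prod I) 𝓘(𝕜, E) ∞ (fun p : Y × X => hf.domChart.extend I p.2)
      (hf.codChart.source ×ˢ hf.domChart.source) :=
    (OpenPartialHomeomorph.contMDiffOn_extend hf.domChart_mem_maximalAtlas).comp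
      contMDiff_snd.contMDiffOn fun p hp => hp.2
  have vertical : ContMDiff 𝓘(𝕜, E) 𝓘(𝕜, hf.complement) ∞ fun u => (hf.equiv u).2 :=
    ((ContinuousLinearMap.snd 𝕜 E' hf.complement).comp
      (hf.equiv : E →L[𝕜] E' × hf.complement)).contMDiff
  exact (hf.equiv.symm : E' × hf.complement →L[𝕜] E).contMDiff.comp_contMDiffOn
    (base.prodMk_space (vertical.comp_contMDiffOn point))

theorem isOpen_retractionDomain [I.Boundaryless] : IsOpen (retractionDomain hf) :=
  (contMDiffOn_fibreCoord hf).continuousOn.isOpen_inter_preimage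
    (hf.codChart.open_source.prod hf.domChart.open_source) hf.domChart.isOpen_extend_target

theorem contMDiffOn_fibreRetraction :
    ContMDiffOn (J.prod I) I ∞ (fibreRetraction hf) (retractionDomain hf) := by
  have chart_symm := contMDiffOn_extend_symm (I := I) hf.domChart_mem_maximalAtlas
  rw [← OpenPartialHomeomorph.extend_target'] at chart_symm
  exact chart_symm.comp ((contMDiffOn_fibreCoord hf).mono inter_subset_left) fun p hp => hp.2

theorem exists_section_of_isSubmersionAt [I.Boundaryless]
    (hf : Manifold.IsSubmersionAt I J ∞ f x₀) :
    ∃ V : Set Y, IsOpen V ∧ f x₀ ∈ V ∧ ∃ σ : Y → X, ContMDiffOn J I ∞ σ V ∧ σ (f x₀) = x₀ ∧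
      ∀ y ∈ V, f (σ y) = y := by
  have inclusion : ContMDiff J (J.prod I) ∞ fun y : Y => (y, x₀) :=
    contMDiff_id.prodMk contMDiff_const
  exact ⟨{y | (y, x₀) ∈ retractionDomain hf},
    (isOpen_retractionDomain hf).preimage inclusion.continuous, mem_retractionDomain_self hf,
    fun y => fibreRetraction hf (y, x₀),
    (contMDiffOn_fibreRetraction hf).comp inclusion.contMDiffOn fun y hy => hy,
    fibreRetraction_self hf (mem_retractionDomain_self hf),
    fun y hy => apply_fibreRetraction hf hy⟩

end Retraction

theorem isSubmersion_comp_fst [IsManifold I ∞ X] [IsManifold K ∞ Z] {f : X → Y}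
    (hf : Manifold.IsSubmersion I J ∞ f) :
    Manifold.IsSubmersion (I.prod K) J ∞ (fun p : X × Z => f p.1) := by
  refine Manifold.IsSubmersionOfComplement.isSubmersion (F := hf.complement × E'') fun p => ?_
  have h := hf.isSubmersionOfComplement_complement p.1
  refine Manifold.IsSubmersionAtOfComplement.mk_of_charts
    ((h.equiv.prodCongr (.refl 𝕜 E'')).trans (.prodAssoc 𝕜 E' hf.complement E''))
    (h.domChart.prod (chartAt H'' p.2)) h.codChart ⟨h.mem_domChart_source, mem_chart_source H'' _⟩
    h.mem_codChart_source ?_ h.codChart_mem_maximalAtlas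
    (fun x hx => h.source_subset_preimage_source hx.1) ?_
  · exact IsManifold.mem_maximalAtlas_prod h.domChart_mem_maximalAtlas
      (IsManifold.chart_mem_maximalAtlas _)
  · rw [OpenPartialHomeomorph.extend_prod, PartialEquiv.prod_target]
    rintro ⟨u, v⟩ ⟨hu, -⟩
    exact h.writtenInCharts hu

theorem isSubmersion_snd [IsManifold I ∞ X] [IsManifold K ∞ Z] :
    Manifold.IsSubmersion (K.prod I) I ∞ (Prod.snd : Z × X → X) := by
  refine Manifold.IsSubmersionOfComplement.isSubmersion (F := E'') fun p => ?_
  refine Manifold.IsSubmersionAtOfComplement.mk_of_charts (.prodComm 𝕜 E'' E)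
    ((chartAt H'' p.1).prod (chartAt H p.2)) (chartAt H p.2)
    ⟨mem_chart_source H'' _, mem_chart_source H _⟩ (mem_chart_source H _) ?_
    (IsManifold.chart_mem_maximalAtlas _) (fun x hx => hx.2) ?_
  · exact IsManifold.mem_maximalAtlas_prod (IsManifold.chart_mem_maximalAtlas _)
      (IsManifold.chart_mem_maximalAtlas _)
  · rw [OpenPartialHomeomorph.extend_prod, PartialEquiv.prod_target]
    rintro ⟨u, v⟩ ⟨-, hv⟩
    exact ((chartAt H p.2).extend I).right_inv hv

end Submersion

/-! ## Paths and tangent vectors -/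

section Paths

variable {𝕜 : Type*} [RCLike 𝕜]
  {E H X : Type*} [NormedAddCommGroup E] [NormedSpace 𝕜 E] [TopologicalSpace H]
  [TopologicalSpace X] [ChartedSpace H X]
  {E' H' Y : Type*} [NormedAddCommGroup E'] [NormedSpace 𝕜 E'] [TopologicalSpace H']
  [TopologicalSpace Y] [ChartedSpace H' Y]
  {I : ModelWithCorners 𝕜 E H} {J : ModelWithCorners 𝕜 E' H'}

/-- The velocity of a path at time `0`, as a vector of the model space. -/
noncomputable def velocity (I : ModelWithCorners 𝕜 E H) (c : 𝕜 → X) : E :=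
  mfderiv 𝓘(𝕜, 𝕜) I c 0 (1 : 𝕜)

theorem velocity_prodMk {c : 𝕜 → X} {d : 𝕜 → Y} (hc : ContMDiffAt 𝓘(𝕜, 𝕜) I ∞ c 0)
    (hd : ContMDiffAt 𝓘(𝕜, 𝕜) J ∞ d 0) :
    velocity (I.prod J) (fun τ => (c τ, d τ)) = (velocity I c, velocity J d) := by
  unfold velocity
  rw [mfderiv_prodMk (hc.mdifferentiableAt (by simp)) (hd.mdifferentiableAt (by simp))]
  rfl

theorem velocity_comp {f : X → Y} {c : 𝕜 → X} {x : X} (hx : c 0 = x)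
    (hf : MDifferentiableAt I J f x) (hc : ContMDiffAt 𝓘(𝕜, 𝕜) I ∞ c 0) :
    velocity J (fun τ => f (c τ)) = mfderiv I J f x (velocity I c : E) := by
  subst hx
  exact congrArg (fun T : 𝕜 →L[𝕜] E' => T 1)
    (mfderiv_comp (0 : 𝕜) hf (hc.mdifferentiableAt (by simp)))

theorem velocity_const (x : X) : velocity I (fun _ : 𝕜 => x) = 0 := by
  unfold velocity
  rw [mfderiv_const]
  rfl

theorem velocity_congr {c d : 𝕜 → X} (h : c =ᶠ[𝓝 0] d) : velocity I c = velocity I d :=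
  congrArg (fun T : 𝕜 →L[𝕜] E => T 1) h.mfderiv_eq

theorem contMDiffAt_comp_path {f : X → Y} {A : Set X} (hf : ContMDiffOn I J ∞ f A) {c : 𝕜 → X}
    (hc : ContMDiffAt 𝓘(𝕜, 𝕜) I ∞ c 0) (hA : ∀ᶠ τ in 𝓝 (0 : 𝕜), c τ ∈ A) :
    ContMDiffAt 𝓘(𝕜, 𝕜) J ∞ (fun τ => f (c τ)) 0 :=
  ((hf _ hA.self_of_nhds).comp (0 : 𝕜) (hc.contMDiffWithinAt (s := c ⁻¹' A))
    (mapsTo_preimage _ _)).contMDiffAt hA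

theorem exists_path_extChartAt_eq [I.Boundaryless] [IsManifold I ∞ X] {x₀ x : X}
    (hx : x ∈ (extChartAt I x₀).source) {u : 𝕜 → E} (hu : ContMDiffAt 𝓘(𝕜, 𝕜) 𝓘(𝕜, E) ∞ u 0)
    (hu₀ : u 0 = extChartAt I x₀ x) :
    ∃ c : 𝕜 → X, c 0 = x ∧ ContMDiffAt 𝓘(𝕜, 𝕜) I ∞ c 0 ∧
      ∀ᶠ τ in 𝓝 (0 : 𝕜), extChartAt I x₀ (c τ) = u τ := by
  have target_mem : (extChartAt I x₀).target ∈ 𝓝 (u 0) := by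
    rw [hu₀]
    exact (isOpen_extChartAt_target x₀).mem_nhds ((extChartAt I x₀).map_source hx)
  refine ⟨fun τ => (extChartAt I x₀).symm (u τ),
    (congrArg _ hu₀).trans ((extChartAt I x₀).left_inv hx),
    ((contMDiffOn_extChartAt_symm (I := I) x₀).contMDiffAt target_mem).comp 0 hu, ?_⟩
  filter_upwards [hu.continuousAt.preimage_mem_nhds target_mem] with τ hτ
  exact (extChartAt I x₀).right_inv hτ

theorem exists_path_velocity_eq [I.Boundaryless] [IsManifold I ∞ X] (x : X) (v : E) :
    ∃ c : 𝕜 → X, c 0 = x ∧ ContMDiffAt 𝓘(𝕜, 𝕜) I ∞ c 0 ∧ velocity I c = v := by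
  have line_smooth : ContDiff 𝕜 ∞ fun τ : 𝕜 => extChartAt I x x + τ • v :=
    contDiff_const.add (contDiff_id.smul contDiff_const)
  obtain ⟨c, hc₀, hc, chart_eq⟩ := exists_path_extChartAt_eq (I := I) (mem_extChartAt_source x)
    line_smooth.contMDiff.contMDiffAt (by simp)
  have line_deriv : HasFDerivAt (fun τ : 𝕜 => extChartAt I x x + τ • v)
      (ContinuousLinearMap.toSpanSingleton 𝕜 v) 0 :=
    ((ContinuousLinearMap.toSpanSingleton 𝕜 v).hasFDerivAt).const_add _
  have hasMFDerivAt : HasMFDerivAt 𝓘(𝕜, 𝕜) I c 0 (ContinuousLinearMap.toSpanSingleton 𝕜 v) := by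
    refine ⟨hc.continuousAt,
      (line_deriv.congr_of_eventuallyEq ?_).hasFDerivWithinAt⟩
    filter_upwards [chart_eq] with τ hτ
    simp only [writtenInExtChartAt, hc₀, extChartAt_model_space_eq_id, PartialEquiv.refl_symm,
      PartialEquiv.refl_coe, Function.comp_apply, id_eq]
    exact hτ
  refine ⟨c, hc₀, hc, ?_⟩
  rw [velocity, hasMFDerivAt.mfderiv]
  exact one_smul 𝕜 v

theorem mem_tangentVectors_of_mem_nhds [I.Boundaryless] [IsManifold I ∞ X] {A : Set X} {x : X}
    (hA : A ∈ 𝓝 x) (v : E) : v ∈ tangentVectors I A x := by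
  obtain ⟨c, rfl, hc, hcv⟩ := exists_path_velocity_eq (I := I) x v
  exact ⟨c, rfl, hc, hc.continuousAt hA, hcv⟩

theorem mfderiv_mem_tangentVectors {f : X → Y} {A : Set X} {B : Set Y} {x : X} {v : E}
    (hf : ContMDiffAt I J ∞ f x) (hAB : MapsTo f A B) (hv : v ∈ tangentVectors I A x) :
    mfderiv I J f x v ∈ tangentVectors J B (f x) := by
  obtain ⟨c, rfl, hc, hcA, rfl⟩ := hv
  exact ⟨fun τ => f (c τ), rfl, hf.comp 0 hc, hcA.mono fun τ hτ => hAB hτ,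
    velocity_comp (I := I) (J := J) rfl (hf.mdifferentiableAt (by simp)) hc⟩

theorem prodMk_self_mem_tangentVectors_diagonal [I.Boundaryless] [IsManifold I ∞ X] (x : X)
    (v : E) : (v, v) ∈ tangentVectors (I.prod I) (diagonal X) (x, x) := by
  obtain ⟨c, rfl, hc, rfl⟩ := exists_path_velocity_eq (I := I) x v
  exact ⟨fun τ => (c τ, c τ), rfl, hc.prodMk hc, Eventually.of_forall fun _ => rfl,
    velocity_prodMk hc hc⟩

end Paths

/-! ## Embedded submanifolds -/

section Submanifold

variable {𝕜 : Type*} [RCLike 𝕜]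
  {E H X : Type*} [NormedAddCommGroup E] [NormedSpace 𝕜 E] [TopologicalSpace H]
  [TopologicalSpace X] [ChartedSpace H X]
  {E' H' Y : Type*} [NormedAddCommGroup E'] [NormedSpace 𝕜 E'] [TopologicalSpace H']
  [TopologicalSpace Y] [ChartedSpace H' Y]
  {E'' H'' W : Type*} [NormedAddCommGroup E''] [NormedSpace 𝕜 E''] [TopologicalSpace H'']
  [TopologicalSpace W] [ChartedSpace H'' W]
  {F : Type*} [NormedAddCommGroup F] [NormedSpace 𝕜 F]
  {I : ModelWithCorners 𝕜 E H} {J : ModelWithCorners 𝕜 E' H'} {K : ModelWithCorners 𝕜 E'' H''}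
  {A : Set X}

theorem IsEmbeddedSubmanifold.preimage (hA : IsEmbeddedSubmanifold I A) {h : Y → X}
    (hh : ContMDiff J I ∞ h) (dh_surjective : ∀ y, Function.Surjective (mfderiv J I h y)) :
    IsEmbeddedSubmanifold J (h ⁻¹' A) := by
  obtain ⟨c, hc⟩ := hA
  refine ⟨c, fun y hy => ?_⟩
  obtain ⟨U, hU, hyU, f, hf, df_surjective, hfA⟩ := hc (h y) hy
  refine ⟨h ⁻¹' U, hU.preimage hh.continuous, hyU, f ∘ h,
    hf.comp hh.contMDiffOn fun _ hz => hz, fun z hz => ?_, fun z hz => hfA (h z) hz⟩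
  rw [mfderiv_comp z ((hf.contMDiffAt (hU.mem_nhds hz)).mdifferentiableAt (by simp))
    (hh.contMDiffAt.mdifferentiableAt (by simp))]
  exact (df_surjective (h z) hz).comp (dh_surjective z)

theorem IsEmbeddedSubmanifold.preimage_diffeomorph (hA : IsEmbeddedSubmanifold I A)
    (e : Diffeomorph J I Y X ∞) : IsEmbeddedSubmanifold J (e ⁻¹' A) :=
  hA.preimage e.contMDiff fun y => (e.mfderivToContinuousLinearEquiv (by simp) y).surjective

theorem IsEmbeddedSubmanifold.prod_univ (hA : IsEmbeddedSubmanifold I A) :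
    IsEmbeddedSubmanifold (I.prod J) (A ×ˢ (univ : Set Y)) := by
  rw [Set.prod_univ]
  refine hA.preimage contMDiff_fst fun p => ?_
  rw [mfderiv_fst]
  exact Prod.fst_surjective

theorem isEmbeddedSubmanifold_univ : IsEmbeddedSubmanifold I (univ : Set X) :=
  ⟨0, fun x _ => ⟨univ, isOpen_univ, mem_univ x, fun _ => 0, contMDiffOn_const,
    fun _ _ v => ⟨0, Subsingleton.elim (α := Fin 0 → 𝕜) _ v⟩, fun _ _ => by simp⟩⟩

theorem IsEmbeddedSubmanifold.isLocallyClosed (hA : IsEmbeddedSubmanifold I A) :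
    IsLocallyClosed A := by
  obtain ⟨c, hc⟩ := hA
  refine ((isLocallyClosed_tfae A).out 0 2).2 fun x hx => ?_
  obtain ⟨U, hU, hxU, f, hf, -, hfA⟩ := hc x hx
  refine ⟨U, hU.mem_nhds hxU, ?_⟩
  have zeros_closed : IsClosed ((fun y : U => f y) ⁻¹' {0}) :=
    isClosed_singleton.preimage (continuousOn_iff_continuous_domRestrict.1 hf.continuousOn)
  convert zeros_closed using 1
  ext y
  exact hfA y y.2

theorem hasDerivAt_comp_path {f : X → F} {c : 𝕜 → X} {x : X} (hx : c 0 = x)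
    (hf : MDifferentiableAt I 𝓘(𝕜, F) f x) (hc : ContMDiffAt 𝓘(𝕜, 𝕜) I ∞ c 0) :
    HasDerivAt (fun τ => f (c τ)) (mfderiv I 𝓘(𝕜, F) f x (velocity I c : E) : F) 0 := by
  subst hx
  have differentiableAt : DifferentiableAt 𝕜 (fun τ => f (c τ)) 0 :=
    mdifferentiableAt_iff_differentiableAt.1 (hf.comp (0 : 𝕜) (hc.mdifferentiableAt (by simp)))
  have deriv_eq : velocity 𝓘(𝕜, F) (fun τ => f (c τ)) = deriv (fun τ => f (c τ)) 0 := by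
    rw [velocity, mfderiv_eq_fderiv]
    exact (fderiv_apply_one_eq_deriv (𝕜 := 𝕜) (f := fun τ => f (c τ)))
  rw [← velocity_comp rfl hf hc, deriv_eq]
  exact differentiableAt.hasDerivAt

theorem mfderiv_surjective_of_hasDerivAt {f : X → F} {x : X}
    (hf : MDifferentiableAt I 𝓘(𝕜, F) f x)
    (h : ∀ w : F, ∃ c : 𝕜 → X, c 0 = x ∧ ContMDiffAt 𝓘(𝕜, 𝕜) I ∞ c 0 ∧
      HasDerivAt (fun τ => f (c τ)) w 0) :
    Function.Surjective (mfderiv I 𝓘(𝕜, F) f x) := fun w => by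
  obtain ⟨c, hc₀, hc, hcw⟩ := h w
  exact ⟨(velocity I c : E), (hasDerivAt_comp_path hc₀ hf hc).unique hcw⟩

theorem isEmbeddedSubmanifold_of_hasDerivAt [FiniteDimensional 𝕜 F]
    (h : ∀ x ∈ A, ∃ U : Set X, IsOpen U ∧ x ∈ U ∧ ∃ f : X → F, ContMDiffOn I 𝓘(𝕜, F) ∞ f U ∧
      (∀ y ∈ U, ∀ w : F, ∃ c : 𝕜 → X, c 0 = y ∧ ContMDiffAt 𝓘(𝕜, 𝕜) I ∞ c 0 ∧
        HasDerivAt (fun τ => f (c τ)) w 0) ∧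
      ∀ y ∈ U, y ∈ A ↔ f y = 0) :
    IsEmbeddedSubmanifold I A := by
  let e : F ≃L[𝕜] (Fin (Module.finrank 𝕜 F) → 𝕜) := (Module.finBasis 𝕜 F).equivFunL
  refine ⟨Module.finrank 𝕜 F, fun x hx => ?_⟩
  obtain ⟨U, hU, hxU, f, hf, paths, hfA⟩ := h x hx
  have ef_smooth : ContMDiffOn I 𝓘(𝕜, Fin (Module.finrank 𝕜 F) → 𝕜) ∞ (fun y => e (f y)) U :=
    (e : F →L[𝕜] (Fin (Module.finrank 𝕜 F) → 𝕜)).contMDiff.comp_contMDiffOn hf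
  refine ⟨U, hU, hxU, fun y => e (f y), ef_smooth, fun y hy => ?_, fun y hy => ?_⟩
  · refine mfderiv_surjective_of_hasDerivAt
      ((ef_smooth.contMDiffAt (hU.mem_nhds hy)).mdifferentiableAt (by simp)) fun w => ?_
    obtain ⟨c, hc₀, hc, hcw⟩ := paths y hy (e.symm w)
    refine ⟨c, hc₀, hc, ?_⟩
    rw [← e.apply_symm_apply w]
    exact (e : F →L[𝕜] (Fin (Module.finrank 𝕜 F) → 𝕜)).hasFDerivAt.comp_hasDerivAt (0 : 𝕜) hcw
  · rw [hfA y hy, map_eq_zero_iff e e.injective]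

theorem hasDerivAt_add_smul (a b : F) : HasDerivAt (fun τ : 𝕜 => a + τ • b) b 0 := by
  simpa only [id_eq, one_smul] using ((hasDerivAt_id (0 : 𝕜)).smul_const b).const_add a

theorem isEmbeddedSubmanifold_fibreProduct [J.Boundaryless] [K.Boundaryless]
    [IsManifold K ∞ W] [FiniteDimensional 𝕜 E''] {h : X → W} {f : Y → W}
    (hh : ContMDiff I K ∞ h) (hf : Manifold.IsSubmersion J K ∞ f) :
    IsEmbeddedSubmanifold (I.prod J) {p : X × Y | h p.1 = f p.2} := by
  refine isEmbeddedSubmanifold_of_hasDerivAt (F := E'') fun p₀ _ => ?_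
  let χ := extChartAt K (f p₀.2)
  have χ_smooth : ContMDiffOn K 𝓘(𝕜, E'') ∞ χ χ.source := by
    rw [extChartAt_source]
    exact contMDiffOn_extChartAt
  have h_fst : ContMDiff (I.prod J) K ∞ fun p : X × Y => h p.1 := hh.comp contMDiff_fst
  have f_snd : ContMDiff (I.prod J) K ∞ fun p : X × Y => f p.2 := hf.contMDiff.comp contMDiff_snd
  have χ_open : IsOpen χ.source := isOpen_extChartAt_source _
  refine ⟨(fun p => h p.1) ⁻¹' χ.source ∩ (fun p => f p.2) ⁻¹' χ.source,
    (χ_open.preimage h_fst.continuous).inter (χ_open.preimage f_snd.continuous), ?_,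
    fun p => χ (f p.2) - χ (h p.1), (χ_smooth.comp f_snd.contMDiffOn fun p hp => hp.2).sub
      (χ_smooth.comp h_fst.contMDiffOn fun p hp => hp.1), ?_, ?_⟩
  · refine ⟨?_, mem_extChartAt_source _⟩
    rw [mem_preimage, show h p₀.1 = f p₀.2 by assumption]
    exact mem_extChartAt_source _
  · rintro ⟨x, y⟩ ⟨-, hy⟩ w
    obtain ⟨V, hV, hyV, σ, hσ, hσy, hfσ⟩ := exists_section_of_isSubmersionAt (hf.isSubmersionAt y)
    obtain ⟨b, hb₀, hb, χ_b⟩ := exists_path_extChartAt_eq (I := K) hy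
      (u := fun τ : 𝕜 => χ (f y) + τ • w)
      (contDiff_const.add (contDiff_id.smul contDiff_const)).contMDiff.contMDiffAt (by simp [χ])
    have b_mem : ∀ᶠ τ in 𝓝 (0 : 𝕜), b τ ∈ V :=
      hb.continuousAt (hV.mem_nhds (by rwa [hb₀]))
    refine ⟨fun τ => (x, σ (b τ)), Prod.ext rfl ((congrArg σ hb₀).trans hσy),
      contMDiffAt_const.prodMk (contMDiffAt_comp_path hσ hb b_mem), ?_⟩
    refine ((hasDerivAt_add_smul (χ (f y)) w).sub_const (χ (h x))).congr_of_eventuallyEq ?_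
    filter_upwards [b_mem, χ_b] with τ hτV hτ
    rw [hfσ _ hτV, hτ]
  · rintro p ⟨hp₁, hp₂⟩
    rw [sub_eq_zero, mem_ofPred_eq, eq_comm]
    exact (χ.injOn.eq_iff hp₂ hp₁).symm

theorem exists_path_hasDerivAt_prodMk_sub [I.Boundaryless] [J.Boundaryless]
    [IsManifold I ∞ X] [IsManifold J ∞ Y] {f : X → F} {k : X → E'} {x : X} {y₀ y : Y}
    (hf : MDifferentiableAt I 𝓘(𝕜, F) f x)
    (df_surjective : Function.Surjective (mfderiv I 𝓘(𝕜, F) f x))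
    (hk : ContMDiffAt I 𝓘(𝕜, E') ∞ k x) (hy : y ∈ (extChartAt J y₀).source) (w : F × E') :
    ∃ c : 𝕜 → X × Y, c 0 = (x, y) ∧ ContMDiffAt 𝓘(𝕜, 𝕜) (I.prod J) ∞ c 0 ∧
      HasDerivAt (fun τ => (f (c τ).1, extChartAt J y₀ (c τ).2 - k (c τ).1)) w 0 := by
  obtain ⟨v, hv⟩ := df_surjective w.1
  obtain ⟨c, rfl, hc, rfl⟩ := exists_path_velocity_eq (I := I) x v
  obtain ⟨d, hd₀, hd, χ_d⟩ := exists_path_extChartAt_eq (I := J) hy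
    (u := fun τ => extChartAt J y₀ y - k (c 0) + τ • w.2 + k (c τ))
    ((contDiff_const.add (contDiff_id.smul contDiff_const)).contMDiff.contMDiffAt.add
      (hk.comp 0 hc)) (by simp)
  refine ⟨fun τ => (c τ, d τ), Prod.ext rfl hd₀, hc.prodMk hd, ?_⟩
  have f_deriv : HasDerivAt (fun τ => f (c τ)) w.1 0 := by
    rw [← hv]
    exact hasDerivAt_comp_path rfl hf hc
  refine f_deriv.prodMk ((hasDerivAt_add_smul (extChartAt J y₀ y - k (c 0))
    w.2).congr_of_eventuallyEq ?_)
  filter_upwards [χ_d] with τ hτ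
  rw [hτ, add_sub_cancel_right]

theorem IsEmbeddedSubmanifold.graphOn [I.Boundaryless] [J.Boundaryless]
    [IsManifold I ∞ X] [IsManifold J ∞ Y] [FiniteDimensional 𝕜 E']
    (hA : IsEmbeddedSubmanifold I A) {a : X → Y} (ha : LocallyExtends I J a A) :
    IsEmbeddedSubmanifold (I.prod J) {p : X × Y | p.1 ∈ A ∧ p.2 = a p.1} := by
  obtain ⟨c, hc⟩ := hA
  refine isEmbeddedSubmanifold_of_hasDerivAt (F := (Fin c → 𝕜) × E') ?_
  rintro ⟨x₀, y₀⟩ ⟨hx₀, rfl : y₀ = a x₀⟩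
  obtain ⟨U₁, hU₁, hx₀U₁, f, hf, df_surjective, hfA⟩ := hc x₀ hx₀
  obtain ⟨U₂, hU₂, hx₀U₂, g, hg, hga⟩ := ha x₀ hx₀
  let χ := extChartAt J (g x₀)
  have χ_smooth : ContMDiffOn J 𝓘(𝕜, E') ∞ χ χ.source := by
    rw [extChartAt_source]
    exact contMDiffOn_extChartAt
  have χ_open : IsOpen χ.source := isOpen_extChartAt_source _
  let U := U₁ ∩ (U₂ ∩ g ⁻¹' χ.source)
  have U_open : IsOpen U := hU₁.inter (hg.continuousOn.isOpen_inter_preimage hU₂ χ_open)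
  have χg_smooth : ContMDiffOn I 𝓘(𝕜, E') ∞ (fun x => χ (g x)) U :=
    χ_smooth.comp (hg.mono fun x hx => hx.2.1) fun x hx => hx.2.2
  refine ⟨U ×ˢ χ.source, U_open.prod χ_open,
    ⟨⟨hx₀U₁, hx₀U₂, mem_extChartAt_source _⟩, ?_⟩,
    fun p => (f p.1, χ p.2 - χ (g p.1)), ?_, ?_, ?_⟩
  · rw [← hga ⟨hx₀U₂, hx₀⟩]
    exact mem_extChartAt_source _
  · exact (hf.comp contMDiff_fst.contMDiffOn fun p hp => hp.1.1).prodMk_space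
      ((χ_smooth.comp contMDiff_snd.contMDiffOn fun p hp => hp.2).sub
        (χg_smooth.comp contMDiff_fst.contMDiffOn fun p hp => hp.1))
  · rintro ⟨x, y⟩ ⟨hx, hy⟩ w
    exact exists_path_hasDerivAt_prodMk_sub
      ((hf.contMDiffAt (hU₁.mem_nhds hx.1)).mdifferentiableAt (by simp)) (df_surjective x hx.1)
      (χg_smooth.contMDiffAt (U_open.mem_nhds hx)) hy w
  · rintro ⟨x, y⟩ ⟨⟨hxU₁, hxU₂, hgx⟩, hy⟩
    rw [Prod.mk_eq_zero, ← hfA x hxU₁, sub_eq_zero, χ.injOn.eq_iff hy hgx]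
    exact and_congr_right fun hxA => by rw [hga ⟨hxU₂, hxA⟩]

theorem locallyExtends_of_contMDiff {f : X → Y} (hf : ContMDiff I J ∞ f) (A : Set X) :
    LocallyExtends I J f A := fun x _ =>
  ⟨univ, isOpen_univ, mem_univ x, f, hf.contMDiffOn, fun _ _ => rfl⟩

theorem isEmbeddedSubmanifold_graph [I.Boundaryless] [J.Boundaryless]
    [IsManifold I ∞ X] [IsManifold J ∞ Y] [FiniteDimensional 𝕜 E] {φ : Y → X}
    (hφ : ContMDiff J I ∞ φ) :
    IsEmbeddedSubmanifold (I.prod J) (range fun y => (φ y, y)) := by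
  have graph_eq : (range fun y => (φ y, y)) =
      Diffeomorph.prodComm I J X Y ∞ ⁻¹' {p : Y × X | p.1 ∈ univ ∧ p.2 = φ p.1} := by
    ext ⟨x, y⟩
    exact ⟨fun ⟨_, h⟩ => ⟨mem_univ _, by cases h; rfl⟩, fun h => ⟨y, Prod.ext h.2.symm rfl⟩⟩
  rw [graph_eq]
  exact (isEmbeddedSubmanifold_univ.graphOn
    (locallyExtends_of_contMDiff hφ univ)).preimage_diffeomorph _

theorem isEmbeddedSubmanifold_diagonal [I.Boundaryless] [IsManifold I ∞ X]
    [FiniteDimensional 𝕜 E] : IsEmbeddedSubmanifold (I.prod I) (diagonal X) := by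
  rw [← range_diag]
  exact isEmbeddedSubmanifold_graph contMDiff_id

end Submanifold

/-! ## Resolutions -/

section Resolution

variable {𝕜 : Type*} [RCLike 𝕜]
  {E H X : Type*} [NormedAddCommGroup E] [NormedSpace 𝕜 E] [TopologicalSpace H]
  [TopologicalSpace X] [ChartedSpace H X]
  {E' H' Y : Type*} [NormedAddCommGroup E'] [NormedSpace 𝕜 E'] [TopologicalSpace H']
  [TopologicalSpace Y] [ChartedSpace H' Y]
  {E'' H'' W : Type*} [NormedAddCommGroup E''] [NormedSpace 𝕜 E''] [TopologicalSpace H'']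
  [TopologicalSpace W] [ChartedSpace H'' W]
  {I : ModelWithCorners 𝕜 E H} {J : ModelWithCorners 𝕜 E' H'} {K : ModelWithCorners 𝕜 E'' H''}
  {f : X → Y} {A : Set X} {B : Set Y}

theorem isDiffeoOn_of_leftInvOn (hfAB : BijOn f A B) (hf : ContMDiffOn I J ∞ f A) {g : Y → X}
    (hgf : LeftInvOn g f A) (hg : ContMDiffOn J I ∞ g B) : IsDiffeoOn I J f A B := by
  refine ⟨hfAB, hf, fun g' hg'f => hg.congr fun y hy => ?_⟩
  obtain ⟨x, hx, rfl⟩ := hfAB.surjOn hy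
  rw [hgf hx, hg'f hx]

namespace IsDiffeoOn

theorem exists_leftInvOn [Nonempty X] (hf : IsDiffeoOn I J f A B) :
    ∃ g, LeftInvOn g f A ∧ ContMDiffOn J I ∞ g B :=
  have leftInvOn := hf.1.injOn.leftInvOn_invFunOn
  ⟨_, leftInvOn, hf.2.2 _ leftInvOn⟩

theorem comp_diffeomorph (hf : IsDiffeoOn I J f A B) (e : Diffeomorph K I W X ∞) :
    IsDiffeoOn K J (f ∘ e) (e ⁻¹' A) B := by
  refine ⟨hf.1.comp e.bijective.bijOn_preimage,
    hf.2.1.comp e.contMDiff.contMDiffOn fun _ hz => hz, fun g hg => ?_⟩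
  have eg_leftInvOn : LeftInvOn (e ∘ g) f A := fun x hx => by
    have hg_symm : g (f (e (e.symm x))) = e.symm x := hg (by rwa [mem_preimage, e.apply_symm_apply])
    rw [Function.comp_apply, ← e.apply_symm_apply x, hg_symm]
  exact (e.symm.contMDiff.comp_contMDiffOn (hf.2.2 _ eg_leftInvOn)).congr
    fun y _ => (e.symm_apply_apply (g y)).symm

theorem prodMap_id (hf : IsDiffeoOn I J f A B) :
    IsDiffeoOn (I.prod K) (J.prod K) (Prod.map f (id : W → W)) (A ×ˢ univ) (B ×ˢ univ) := by
  have bijOn := hf.1.prodMap (bijOn_id (univ : Set W))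
  have smooth := hf.2.1.prodMap (contMDiffOn_id (I := K) (s := (univ : Set W)))
  refine ⟨bijOn, smooth, fun g hg p hp => ?_⟩
  obtain ⟨x, -⟩ := hf.1.surjOn hp.1
  have : Nonempty X := ⟨x⟩
  obtain ⟨f', hf'f, hf'⟩ := hf.exists_leftInvOn
  exact (isDiffeoOn_of_leftInvOn bijOn smooth (g := Prod.map f' id)
    (fun p hp => Prod.ext (hf'f hp.1) rfl) (hf'.prodMap contMDiffOn_id)).2.2 g hg p hp

theorem exists_mfderiv_eq_of_mem_tangentVectors (hf : IsDiffeoOn I J f A B) {x : X} (hx : x ∈ A)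
    (f_smoothAt : ContMDiffAt I J ∞ f x) {v : E'} (hv : v ∈ tangentVectors J B (f x)) :
    ∃ w : E, mfderiv I J f x w = v := by
  obtain ⟨c, hc₀, hc, hcB, rfl⟩ := hv
  have : Nonempty X := ⟨x⟩
  obtain ⟨g, hgf, hg⟩ := hf.exists_leftInvOn
  have gc_zero : g (c 0) = x := by rw [hc₀, hgf hx]
  have gc_smooth := contMDiffAt_comp_path hg hc hcB
  refine ⟨velocity I fun τ => g (c τ), ?_⟩
  refine (velocity_comp (c := fun τ => g (c τ)) gc_zero (f_smoothAt.mdifferentiableAt (by simp))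
    gc_smooth).symm.trans (velocity_congr ?_)
  filter_upwards [hcB] with τ hτ
  rw [← hf.1.image_eq] at hτ
  exact hgf.rightInvOn_image hτ

end IsDiffeoOn

namespace IsResolution

variable {S : Set Y} {φ : X → Y}

theorem comp_diffeomorph (hφ : IsResolution I J S φ) (e : Diffeomorph K I W X ∞) :
    IsResolution K J S (φ ∘ e) :=
  ⟨hφ.1.comp e.contMDiff, hφ.2.1.preimage e.toHomeomorph.isOpenMap, hφ.2.2.comp_diffeomorph e⟩

theorem prodMap_id (hφ : IsResolution I J S φ) :
    IsResolution (I.prod K) (J.prod K) (S ×ˢ univ) (Prod.map φ (id : W → W)) :=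
  ⟨hφ.1.prodMap contMDiff_id, hφ.2.1.prod dense_univ, hφ.2.2.prodMap_id⟩

theorem isOpen_preimage (hφ : IsResolution I J S φ) (hS : IsEmbeddedSubmanifold J S) :
    IsOpen (φ ⁻¹' S) := by
  have coborder_open := (hS.isLocallyClosed.preimage hφ.1.continuous).isOpen_coborder
  have inter_coborder := closure_inter_coborder (s := φ ⁻¹' S)
  rw [hφ.2.1.closure_eq, univ_inter] at inter_coborder
  rwa [inter_coborder] at coborder_open

theorem mem_tangentVectors_iff [I.Boundaryless] [IsManifold I ∞ X] (hφ : IsResolution I J S φ)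
    (hS : IsEmbeddedSubmanifold J S) {x : X} (hx : φ x ∈ S) {v : E'} :
    v ∈ tangentVectors J S (φ x) ↔ ∃ w : E, mfderiv I J φ x w = v := by
  refine ⟨hφ.2.2.exists_mfderiv_eq_of_mem_tangentVectors hx hφ.1.contMDiffAt, ?_⟩
  rintro ⟨w, rfl⟩
  exact mfderiv_mem_tangentVectors hφ.1.contMDiffAt (fun _ hz => hz)
    (mem_tangentVectors_of_mem_nhds ((hφ.isOpen_preimage hS).mem_nhds hx) w)

end IsResolution

end Resolution

/-! ## The natural Morita equivalence -/

namespace SetGroupoid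

section Cancellation

variable {G M Z : Type*} (Γ : SetGroupoid G M)

theorem inv_inv (g : G) : Γ.inv (Γ.inv g) = g :=
  (Γ.eq_inv_of_mul (Γ.tgt_inv g) (by rw [Γ.inv_mul, Γ.src_inv])).symm

theorem mul_inv_cancel_right {g h : G} (hgh : Γ.tgt g = Γ.src h) :
    Γ.mul (Γ.mul g h) (Γ.inv h) = g := by
  rw [Γ.mul_assoc _ _ _ hgh (Γ.src_inv h).symm, Γ.mul_inv, ← hgh, Γ.mul_unit]

theorem inv_mul_cancel_left {g h : G} (hgh : Γ.tgt g = Γ.src h) :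
    Γ.mul (Γ.inv g) (Γ.mul g h) = h := by
  rw [← Γ.mul_assoc _ _ _ (Γ.tgt_inv g) hgh, Γ.inv_mul, hgh, Γ.unit_mul]

theorem inv_mul_cancel_right {g h : G} (hgh : Γ.tgt g = Γ.tgt h) :
    Γ.mul (Γ.mul g (Γ.inv h)) h = g := by
  simpa only [Γ.inv_inv] using Γ.mul_inv_cancel_right (hgh.trans (Γ.src_inv h).symm)

theorem mul_inv_cancel_left {g h : G} (hgh : Γ.src g = Γ.src h) :
    Γ.mul g (Γ.mul (Γ.inv g) h) = h := by
  simpa only [Γ.inv_inv] using Γ.inv_mul_cancel_left ((Γ.tgt_inv g).trans hgh)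

theorem mul_right_cancel {g h k : G} (hg : Γ.tgt g = Γ.src k) (hh : Γ.tgt h = Γ.src k)
    (e : Γ.mul g k = Γ.mul h k) : g = h := by
  rw [← Γ.mul_inv_cancel_right hg, e, Γ.mul_inv_cancel_right hh]

theorem mul_left_cancel {g h k : G} (hg : Γ.tgt k = Γ.src g) (hh : Γ.tgt k = Γ.src h)
    (e : Γ.mul k g = Γ.mul k h) : g = h := by
  rw [← Γ.inv_mul_cancel_left hg, e, Γ.inv_mul_cancel_left hh]

namespace RightModule

variable {Γ} (N : Γ.RightModule Z) {z : Z} {g : G}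

theorem act_act_inv (h : N.anchor z = Γ.src g) : N.act (N.act z g) (Γ.inv g) = z := by
  rw [← N.act_mul _ _ _ h (Γ.src_inv g).symm, Γ.mul_inv, ← h, N.act_unit]

theorem act_inv_act (h : N.anchor z = Γ.tgt g) : N.act (N.act z (Γ.inv g)) g = z := by
  simpa only [Γ.inv_inv] using N.act_act_inv (h.trans (Γ.src_inv g).symm)

theorem anchor_act_inv (h : N.anchor z = Γ.tgt g) : N.anchor (N.act z (Γ.inv g)) = Γ.src g := by
  rw [N.anchor_act _ _ (h.trans (Γ.src_inv g).symm), Γ.tgt_inv]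

end RightModule

end Cancellation

section Algebra

variable {G M G' M' Z : Type*} {Γ : SetGroupoid G M}

theorem IsStable.prod_univ {S : Set M} (hS : Γ.IsStable S) (Γ' : SetGroupoid G' M') :
    (Γ.prod Γ').IsStable (S ×ˢ univ) := fun g => and_congr_left' (hS g.1)

variable (Γ Z)

theorem naturalBimodule_mapStable {S : Set M} (hS : Γ.IsStable S) :
    (Γ.naturalBimodule Z).mapStable S = S ×ˢ univ := by
  ext ⟨m, z⟩
  constructor
  · rintro ⟨x, hx, h⟩
    obtain ⟨rfl, -⟩ := Prod.ext_iff.1 h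
    exact ⟨(hS x.1).2 hx, mem_univ _⟩
  · rintro ⟨hm, -⟩
    have src_unit_mem : Γ.src (Γ.unit m) ∈ S := by rwa [Γ.src_unit]
    exact ⟨(Γ.unit m, z), src_unit_mem, Prod.ext (Γ.tgt_unit m) rfl⟩

theorem naturalBimodule_left_free (g h : G) (x : G × Z)
    (hg : Γ.tgt g = (Γ.naturalBimodule Z).left.anchor x)
    (hh : Γ.tgt h = (Γ.naturalBimodule Z).left.anchor x)
    (e : (Γ.naturalBimodule Z).left.act g x = (Γ.naturalBimodule Z).left.act h x) : g = h :=
  Γ.mul_right_cancel hg hh (congrArg Prod.fst e)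

theorem naturalBimodule_right_free (x : G × Z) (g h : G × (Z × Z))
    (hg : (Γ.naturalBimodule Z).right.anchor x = (Γ.prod (pair Z)).src g)
    (hh : (Γ.naturalBimodule Z).right.anchor x = (Γ.prod (pair Z)).src h)
    (e : (Γ.naturalBimodule Z).right.act x g = (Γ.naturalBimodule Z).right.act x h) : g = h := by
  obtain ⟨hg₁, hg₂⟩ := Prod.ext_iff.1 hg
  obtain ⟨hh₁, hh₂⟩ := Prod.ext_iff.1 hh
  obtain ⟨e₁, e₂⟩ := Prod.ext_iff.1 e
  exact Prod.ext (Γ.mul_left_cancel hg₁ hh₁ e₁) (Prod.ext (hg₂.symm.trans hh₂) e₂)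

theorem naturalBimodule_left_transitive (x y : G × Z)
    (hxy : (Γ.naturalBimodule Z).right.anchor x = (Γ.naturalBimodule Z).right.anchor y) :
    ∃ g, Γ.tgt g = (Γ.naturalBimodule Z).left.anchor x ∧
      (Γ.naturalBimodule Z).left.act g x = y := by
  obtain ⟨tgt_eq, snd_eq⟩ := Prod.ext_iff.1 hxy
  refine ⟨Γ.mul y.1 (Γ.inv x.1), ?_, Prod.ext (Γ.inv_mul_cancel_right tgt_eq.symm) snd_eq⟩
  exact (Γ.tgt_mul _ _ (tgt_eq.symm.trans (Γ.src_inv _).symm)).trans (Γ.tgt_inv _)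

theorem naturalBimodule_right_transitive (x y : G × Z)
    (hxy : (Γ.naturalBimodule Z).left.anchor x = (Γ.naturalBimodule Z).left.anchor y) :
    ∃ g, (Γ.naturalBimodule Z).right.anchor x = (Γ.prod (pair Z)).src g ∧
      (Γ.naturalBimodule Z).right.act x g = y := by
  refine ⟨(Γ.mul (Γ.inv x.1) y.1, (x.2, y.2)), Prod.ext ?_ rfl,
    Prod.ext (Γ.mul_inv_cancel_left hxy) rfl⟩
  exact (Γ.src_inv _).symm.trans (Γ.src_mul _ _ ((Γ.tgt_inv _).trans hxy)).symm

end Algebra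

section Smooth

variable {𝕜 : Type*} [RCLike 𝕜]
  {E₁ H₁ G : Type*} [NormedAddCommGroup E₁] [NormedSpace 𝕜 E₁] [TopologicalSpace H₁]
  [TopologicalSpace G] [ChartedSpace H₁ G]
  {E₂ H₂ M : Type*} [NormedAddCommGroup E₂] [NormedSpace 𝕜 E₂] [TopologicalSpace H₂]
  [TopologicalSpace M] [ChartedSpace H₂ M]
  {E₃ H₃ Z : Type*} [NormedAddCommGroup E₃] [NormedSpace 𝕜 E₃] [TopologicalSpace H₃]
  [TopologicalSpace Z] [ChartedSpace H₃ Z]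
  {E₄ H₄ G' : Type*} [NormedAddCommGroup E₄] [NormedSpace 𝕜 E₄] [TopologicalSpace H₄]
  [TopologicalSpace G'] [ChartedSpace H₄ G']
  {E₅ H₅ M' : Type*} [NormedAddCommGroup E₅] [NormedSpace 𝕜 E₅] [TopologicalSpace H₅]
  [TopologicalSpace M'] [ChartedSpace H₅ M']
  {I : ModelWithCorners 𝕜 E₁ H₁} {J : ModelWithCorners 𝕜 E₂ H₂} {K : ModelWithCorners 𝕜 E₃ H₃}
  {I' : ModelWithCorners 𝕜 E₄ H₄} {J' : ModelWithCorners 𝕜 E₅ H₅}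
  {Γ : SetGroupoid G M} {Γ' : SetGroupoid G' M'}

theorem IsLie.contMDiffOn_mul (hΓ : Γ.IsLie I J) {f g : Z → G} {A : Set Z}
    (hf : ContMDiffOn K I ∞ f A) (hg : ContMDiffOn K I ∞ g A)
    (hfg : ∀ z ∈ A, Γ.tgt (f z) = Γ.src (g z)) :
    ContMDiffOn K I ∞ (fun z => Γ.mul (f z) (g z)) A :=
  hΓ.mul.comp (hf.prodMk hg) hfg

theorem IsLie.continuous_mul (hΓ : Γ.IsLie I J) {T : Type*} [TopologicalSpace T] {f g : T → G}
    (hf : Continuous f) (hg : Continuous g) (hfg : ∀ t, Γ.tgt (f t) = Γ.src (g t)) :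
    Continuous fun t => Γ.mul (f t) (g t) :=
  hΓ.mul.continuousOn.comp_continuous (hf.prodMk hg) hfg

theorem isLie_pair [IsManifold K ∞ Z] : (pair Z).IsLie (K.prod K) K where
  src := isSubmersion_comp_fst Manifold.IsSubmersion.id
  tgt := isSubmersion_snd
  unit := contMDiff_id.prodMk contMDiff_id
  inv := contMDiff_snd.prodMk contMDiff_fst
  mul := (contMDiff_fst.fst.prodMk contMDiff_snd.snd).contMDiffOn

theorem IsLie.prod [IsManifold I ∞ G] [IsManifold J ∞ M] [IsManifold I' ∞ G']
    [IsManifold J' ∞ M'] (hΓ : Γ.IsLie I J) (hΓ' : Γ'.IsLie I' J') :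
    (Γ.prod Γ').IsLie (I.prod I') (J.prod J') where
  src := hΓ.src.prodMap hΓ'.src
  tgt := hΓ.tgt.prodMap hΓ'.tgt
  unit := hΓ.unit.prodMap hΓ'.unit
  inv := hΓ.inv.prodMap hΓ'.inv
  mul :=
    (hΓ.contMDiffOn_mul contMDiff_fst.fst.contMDiffOn contMDiff_snd.fst.contMDiffOn
      fun _ hq => (Prod.ext_iff.1 hq).1).prodMk
    (hΓ'.contMDiffOn_mul contMDiff_fst.snd.contMDiffOn contMDiff_snd.snd.contMDiffOn
      fun _ hq => (Prod.ext_iff.1 hq).2)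

theorem IsLie.naturalBimodule_left_isSmooth (hΓ : Γ.IsLie I J) :
    (Γ.naturalBimodule Z).left.IsSmooth I J (I.prod K) where
  anchor := hΓ.src.contMDiff.comp contMDiff_fst
  act := (hΓ.contMDiffOn_mul contMDiff_fst.contMDiffOn contMDiff_snd.fst.contMDiffOn
    fun _ hq => hq).prodMk contMDiff_snd.snd.contMDiffOn

theorem IsLie.naturalBimodule_right_isSmooth (hΓ : Γ.IsLie I J) :
    (Γ.naturalBimodule Z).right.IsSmooth (I.prod (K.prod K)) (J.prod K) (I.prod K) where
  anchor := hΓ.tgt.contMDiff.prodMap contMDiff_id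
  act := (hΓ.contMDiffOn_mul contMDiff_fst.fst.contMDiffOn contMDiff_snd.fst.contMDiffOn
    fun _ hq => (Prod.ext_iff.1 hq).1).prodMk contMDiff_snd.snd.snd.contMDiffOn

theorem isProperMap_of_closed_range {T T' : Type*} [TopologicalSpace T] [TopologicalSpace T']
    {f : T → T'} (hf : Continuous f) {C : Set T'} (hC : IsClosed C) (hfC : ∀ x, f x ∈ C)
    {g : C → T} (hg : Continuous g) (hgf : ∀ x, g ⟨f x, hfC x⟩ = x) (hfg : ∀ y, f (g y) = y) :
    IsProperMap f := by
  let e : T ≃ₜ C :=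
    { toFun := fun x => ⟨f x, hfC x⟩
      invFun := g
      left_inv := hgf
      right_inv := fun y => Subtype.ext (hfg y)
      continuous_toFun := hf.subtype_mk _
      continuous_invFun := hg }
  exact hC.isClosedEmbedding_subtypeVal.isProperMap.comp e.isProperMap

variable (Z) [T2Space M]

theorem IsLie.naturalBimodule_left_isProperMap [T2Space Z] (hΓ : Γ.IsLie I J) :
    IsProperMap (fun q : {q : G × (G × Z) // Γ.tgt q.1 = (Γ.naturalBimodule Z).left.anchor q.2} =>
      ((Γ.naturalBimodule Z).left.act q.1.1 q.1.2, q.1.2)) := by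
  have continuous_tgt := hΓ.tgt.contMDiff.continuous
  have continuous_inv := hΓ.inv.continuous
  let C := {y : (G × Z) × (G × Z) | Γ.tgt y.1.1 = Γ.tgt y.2.1 ∧ y.1.2 = y.2.2}
  have hC : IsClosed C :=
    (isClosed_eq (by fun_prop) (by fun_prop)).inter (isClosed_eq (by fun_prop) (by fun_prop))
  have composable (y : C) : Γ.tgt y.1.1.1 = Γ.src (Γ.inv y.1.2.1) :=
    y.2.1.trans (Γ.src_inv _).symm
  refine isProperMap_of_closed_range (C := C) ?_ hC (fun q => ⟨Γ.tgt_mul _ _ q.2, rfl⟩)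
    (g := fun y => ⟨(Γ.mul y.1.1.1 (Γ.inv y.1.2.1), y.1.2),
      (Γ.tgt_mul _ _ (composable y)).trans (Γ.tgt_inv _)⟩) ?_ ?_ ?_
  · exact ((hΓ.continuous_mul (by fun_prop) (by fun_prop) fun q => q.2).prodMk
      (by fun_prop)).prodMk (by fun_prop)
  · exact ((hΓ.continuous_mul (by fun_prop) (by fun_prop) composable).prodMk
      (by fun_prop)).subtype_mk _
  · rintro ⟨⟨g, x⟩, hg⟩
    exact Subtype.ext (Prod.ext (Γ.mul_inv_cancel_right hg) rfl)
  · rintro ⟨⟨x, y⟩, tgt_eq, snd_eq⟩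
    exact Prod.ext (Prod.ext (Γ.inv_mul_cancel_right tgt_eq) snd_eq.symm) rfl

theorem IsLie.naturalBimodule_right_isProperMap (hΓ : Γ.IsLie I J) :
    IsProperMap (fun q : {q : (G × Z) × (G × (Z × Z)) //
        (Γ.naturalBimodule Z).right.anchor q.1 = (Γ.prod (pair Z)).src q.2} =>
      (q.1.1, (Γ.naturalBimodule Z).right.act q.1.1 q.1.2)) := by
  have continuous_src := hΓ.src.contMDiff.continuous
  have continuous_inv := hΓ.inv.continuous
  let C := {y : (G × Z) × (G × Z) | Γ.src y.1.1 = Γ.src y.2.1}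
  have hC : IsClosed C := isClosed_eq (by fun_prop) (by fun_prop)
  have composable (y : C) : Γ.tgt (Γ.inv y.1.1.1) = Γ.src y.1.2.1 := (Γ.tgt_inv _).trans y.2
  refine isProperMap_of_closed_range (C := C) ?_ hC
    (fun q => (Γ.src_mul _ _ (Prod.ext_iff.1 q.2).1).symm)
    (g := fun y => ⟨(y.1.1, (Γ.mul (Γ.inv y.1.1.1) y.1.2.1, (y.1.1.2, y.1.2.2))),
      Prod.ext ((Γ.src_inv _).symm.trans (Γ.src_mul _ _ (composable y)).symm) rfl⟩) ?_ ?_ ?_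
  · exact Continuous.prodMk (by fun_prop) ((hΓ.continuous_mul (by fun_prop) (by fun_prop)
      fun q => (Prod.ext_iff.1 q.2).1).prodMk (by fun_prop))
  · exact Continuous.subtype_mk (Continuous.prodMk (by fun_prop)
      ((hΓ.continuous_mul (by fun_prop) (by fun_prop) composable).prodMk (by fun_prop))) _
  · rintro ⟨⟨x, g⟩, hg⟩
    obtain ⟨tgt_eq, snd_eq⟩ := Prod.ext_iff.1 hg
    exact Subtype.ext
      (Prod.ext rfl (Prod.ext (Γ.inv_mul_cancel_left tgt_eq) (Prod.ext snd_eq rfl)))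
  · rintro ⟨⟨x, y⟩, hxy⟩
    exact Prod.ext rfl (Prod.ext (Γ.mul_inv_cancel_left hxy) rfl)

theorem IsLie.naturalBimodule_isMorita [IsManifold I ∞ G] [IsManifold J ∞ M] [IsManifold K ∞ Z]
    [T2Space Z] [Nonempty Z] (hΓ : Γ.IsLie I J) :
    (Γ.naturalBimodule Z).IsMorita I J (I.prod (K.prod K)) (J.prod K) (I.prod K) where
  smooth_left := hΓ.naturalBimodule_left_isSmooth
  smooth_right := hΓ.naturalBimodule_right_isSmooth
  surjective_left m := ⟨(Γ.unit m, Classical.arbitrary Z), Γ.src_unit m⟩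
  submersion_left := isSubmersion_comp_fst hΓ.src
  surjective_right m := ⟨(Γ.unit m.1, m.2), Prod.ext (Γ.tgt_unit _) rfl⟩
  submersion_right := hΓ.tgt.prodMap Manifold.IsSubmersion.id
  free_left := Γ.naturalBimodule_left_free Z
  free_right := Γ.naturalBimodule_right_free Z
  transitive_left := Γ.naturalBimodule_left_transitive Z
  transitive_right := Γ.naturalBimodule_right_transitive Z
  proper_left := hΓ.naturalBimodule_left_isProperMap Z
  proper_right := hΓ.naturalBimodule_right_isProperMap Z

end Smooth

end SetGroupoid

/-! ## Compatible resolutions and the groupoid of the diagonal -/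

namespace SetGroupoid

/-- The rearrangement `(g, (z, y)) ↦ ((z, g), y)`, which turns an arrow of `Γ × (Z × Z ⇉ Z)` into an
argument of the action of `Γ` on `Z` and a spectator in `Z`. -/
def arrowRegrouping {𝕜 : Type*} [NontriviallyNormedField 𝕜]
    {E₁ H₁ : Type*} [NormedAddCommGroup E₁] [NormedSpace 𝕜 E₁] [TopologicalSpace H₁]
    {E₃ H₃ : Type*} [NormedAddCommGroup E₃] [NormedSpace 𝕜 E₃] [TopologicalSpace H₃]
    (I : ModelWithCorners 𝕜 E₁ H₁) (K : ModelWithCorners 𝕜 E₃ H₃)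
    (G : Type*) [TopologicalSpace G] [ChartedSpace H₁ G]
    (Z : Type*) [TopologicalSpace Z] [ChartedSpace H₃ Z] :
    Diffeomorph (I.prod (K.prod K)) ((K.prod I).prod K) (G × (Z × Z)) ((Z × G) × Z) ∞ :=
  (Diffeomorph.prodAssoc I K K G Z Z ∞).symm.trans
    ((Diffeomorph.prodComm I K G Z ∞).prodCongr (Diffeomorph.refl K Z ∞))

namespace RightModule

section Algebra

variable {G M Z : Type*} {Γ : SetGroupoid G M} (N : Γ.RightModule Z) {Lt : Set Z} {r r' : G}

theorem src_mem_of_mem_arrowsOf (hr : r ∈ N.arrowsOf Lt) : Γ.src r ∈ N.anchor '' Lt := by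
  obtain ⟨z, hz, hzr, -⟩ := hr
  exact ⟨z, hz, hzr⟩

theorem tgt_mem_of_mem_arrowsOf (hr : r ∈ N.arrowsOf Lt) : Γ.tgt r ∈ N.anchor '' Lt := by
  obtain ⟨z, -, hzr, hact⟩ := hr
  exact ⟨_, hact, N.anchor_act z r hzr⟩

theorem unit_mem_arrowsOf {z : Z} (hz : z ∈ Lt) : Γ.unit (N.anchor z) ∈ N.arrowsOf Lt :=
  ⟨z, hz, (Γ.src_unit _).symm, by rwa [N.act_unit]⟩

theorem inv_mem_arrowsOf (hr : r ∈ N.arrowsOf Lt) : Γ.inv r ∈ N.arrowsOf Lt := by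
  obtain ⟨z, hz, hzr, hact⟩ := hr
  refine ⟨_, hact, (N.anchor_act z r hzr).trans (Γ.src_inv r).symm, ?_⟩
  rwa [N.act_act_inv hzr]

theorem mul_mem_arrowsOf (hLt : InjOn N.anchor Lt) (hr : r ∈ N.arrowsOf Lt)
    (hr' : r' ∈ N.arrowsOf Lt) (h : Γ.tgt r = Γ.src r') : Γ.mul r r' ∈ N.arrowsOf Lt := by
  obtain ⟨z, hz, hzr, hact⟩ := hr
  obtain ⟨z', hz', hzr', hact'⟩ := hr'
  obtain rfl : z' = N.act z r :=
    hLt hz' hact (by rw [N.anchor_act z r hzr, h, hzr'])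
  refine ⟨z, hz, by rw [hzr, Γ.src_mul _ _ h], ?_⟩
  rwa [N.act_mul _ _ _ hzr h]

theorem mem_arrowsOf_diagonal {r : G × (Z × Z)} :
    r ∈ N.hat.arrowsOf (diagonal Z) ↔ N.anchor r.2.1 = Γ.src r.1 ∧ r.2.2 = N.act r.2.1 r.1 := by
  constructor
  · rintro ⟨⟨z, w⟩, (rfl : z = w), hsrc, hact⟩
    obtain ⟨anchor_eq, rfl : z = r.2.1⟩ := Prod.ext_iff.1 hsrc
    exact ⟨anchor_eq, hact.symm⟩
  · rintro ⟨anchor_eq, hact⟩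
    exact ⟨(r.2.1, r.2.1), rfl, Prod.ext anchor_eq rfl, hact.symm⟩

theorem mem_range_graph {m : M × Z} :
    (m ∈ range fun z => (N.anchor z, z)) ↔ N.anchor m.2 = m.1 :=
  ⟨by rintro ⟨z, rfl⟩; rfl, fun h => ⟨m.2, Prod.ext h rfl⟩⟩

theorem hat_bijOn_diagonal :
    BijOn N.hat.anchor (diagonal Z) (range fun z => (N.anchor z, z)) := by
  refine ⟨?_, ?_, ?_⟩
  · rintro ⟨z, w⟩ (rfl : z = w)
    exact ⟨z, rfl⟩
  · rintro ⟨z, w⟩ (rfl : z = w) ⟨y, x⟩ (rfl : y = x) e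
    obtain rfl : z = y := (Prod.ext_iff.1 e).2
    rfl
  · rintro _ ⟨z, rfl⟩
    exact ⟨(z, z), rfl, rfl⟩

theorem dense_graph_inter [TopologicalSpace M] [TopologicalSpace Z] {S : Set M}
    (hφ : Continuous N.anchor) (hS : Dense (N.anchor ⁻¹' S)) :
    (range fun z => (N.anchor z, z)) ⊆
      closure ((range fun z => (N.anchor z, z)) ∩ S ×ˢ univ) := by
  rintro _ ⟨z, rfl⟩
  have continuous_graph : Continuous fun z => (N.anchor z, z) := by fun_prop
  exact map_mem_closure (f := fun z => (N.anchor z, z)) continuous_graph (hS z) fun y hy =>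
    ⟨mem_range_self y, hy, mem_univ _⟩

end Algebra

section PairFactor

variable {𝕜 : Type*} [RCLike 𝕜]
  {E₁ H₁ G : Type*} [NormedAddCommGroup E₁] [NormedSpace 𝕜 E₁] [TopologicalSpace H₁]
  [TopologicalSpace G] [ChartedSpace H₁ G]
  {E₃ H₃ Z : Type*} [NormedAddCommGroup E₃] [NormedSpace 𝕜 E₃] [TopologicalSpace H₃]
  [TopologicalSpace Z] [ChartedSpace H₃ Z]
  {I : ModelWithCorners 𝕜 E₁ H₁} {K : ModelWithCorners 𝕜 E₃ H₃}
  {M : Type*} {Γ : SetGroupoid G M} (N : Γ.RightModule Z)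

theorem prodMk_zero_mem_orbitTangent_hat [K.Boundaryless] [IsManifold K ∞ Z] (z y : Z) (u : E₃) :
    (0, u) ∈ N.hat.orbitTangent (I.prod (K.prod K)) (K.prod K) (z, y) := by
  obtain ⟨d, hd₀, hd, rfl⟩ := exists_path_velocity_eq (I := K) y u
  refine ⟨fun τ => (Γ.unit (N.anchor z), (y, d τ)), Prod.ext rfl (Prod.ext rfl hd₀),
    contMDiffAt_const.prodMk (contMDiffAt_const.prodMk hd),
    Eventually.of_forall fun _ => Prod.ext (Γ.src_unit _) rfl, ?_⟩
  have act_eq (τ : 𝕜) : N.hat.act (z, y) (Γ.unit (N.anchor z), (y, d τ)) = (z, d τ) :=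
    Prod.ext (N.act_unit z) rfl
  exact (velocity_congr (I := K.prod K) (Eventually.of_forall act_eq)).trans
    ((velocity_prodMk (I := K) contMDiffAt_const hd).trans (Prod.ext (velocity_const z) rfl))

end PairFactor

section Smooth

variable {𝕜 : Type*} [RCLike 𝕜]
  {E₁ H₁ G : Type*} [NormedAddCommGroup E₁] [NormedSpace 𝕜 E₁] [TopologicalSpace H₁]
  [TopologicalSpace G] [ChartedSpace H₁ G]
  {E₂ H₂ M : Type*} [NormedAddCommGroup E₂] [NormedSpace 𝕜 E₂] [TopologicalSpace H₂]
  [TopologicalSpace M] [ChartedSpace H₂ M]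
  {E₃ H₃ Z : Type*} [NormedAddCommGroup E₃] [NormedSpace 𝕜 E₃] [TopologicalSpace H₃]
  [TopologicalSpace Z] [ChartedSpace H₃ Z]
  {I : ModelWithCorners 𝕜 E₁ H₁} {J : ModelWithCorners 𝕜 E₂ H₂} {K : ModelWithCorners 𝕜 E₃ H₃}
  {Γ : SetGroupoid G M} {N : Γ.RightModule Z} {S L : Set M} {Lt : Set Z}

theorem IsSmooth.mem_orbitTangent_anchor_iff (hN : N.IsSmooth I J K) {z : Z} {v : E₂} :
    v ∈ Γ.orbitTangent I J (N.anchor z) ↔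
      ∃ w ∈ N.orbitTangent I K z, mfderiv K J N.anchor z w = v := by
  have velocity_tgt {c : 𝕜 → G} (hc₀ : c 0 = Γ.unit (N.anchor z))
      (hc : ContMDiffAt 𝓘(𝕜, 𝕜) I ∞ c 0) (hcs : ∀ᶠ τ in 𝓝 (0 : 𝕜), Γ.src (c τ) = N.anchor z) :
      velocity J (fun τ => Γ.tgt (c τ)) =
        mfderiv K J N.anchor z (velocity K fun τ => N.act z (c τ) : E₃) := by
    have composable : ∀ᶠ τ in 𝓝 (0 : 𝕜), N.anchor z = Γ.src (c τ) := hcs.mono fun _ h => h.symm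
    refine (velocity_congr (composable.mono fun τ h => (N.anchor_act z (c τ) h).symm)).trans
      (velocity_comp (by rw [hc₀, N.act_unit]) (hN.anchor.mdifferentiable (by simp) z) ?_)
    exact contMDiffAt_comp_path hN.act (contMDiffAt_const.prodMk hc) composable
  constructor
  · rintro ⟨c, hc₀, hc, hcs, rfl⟩
    exact ⟨_, ⟨c, hc₀, hc, hcs, rfl⟩, (velocity_tgt hc₀ hc hcs).symm⟩
  · rintro ⟨_, ⟨c, hc₀, hc, hcs, rfl⟩, rfl⟩
    exact ⟨c, hc₀, hc, hcs, velocity_tgt hc₀ hc hcs⟩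

theorem IsCompatibleVia.mem_tangentVectors_iff [K.Boundaryless] [IsManifold K ∞ Z]
    (hc : N.IsCompatibleVia I J K S L Lt) (hN : N.IsEquivariantResolution I J K S)
    (hS : IsEmbeddedSubmanifold J S) {m : M} (hm : m ∈ L ∩ S) {v : TangentSpace J m} :
    v ∈ tangentVectors J S m ↔
      ∃ a ∈ Γ.orbitTangent I J m, ∃ b ∈ tangentVectors J L m, v = a + b := by
  obtain ⟨hmL, hmS⟩ := hm
  obtain ⟨z, hz, rfl⟩ := hc.diffeo.1.surjOn hmL
  have φ_smoothAt := hN.1.anchor.contMDiffAt (x := z)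
  constructor
  · intro hv
    obtain ⟨w, rfl⟩ := (hN.2.mem_tangentVectors_iff hS hmS).1 hv
    obtain ⟨a, ha, b, hb, rfl⟩ := hc.transverse z hz w
    exact ⟨_, hN.1.mem_orbitTangent_anchor_iff.2 ⟨a, ha, rfl⟩, _,
      mfderiv_mem_tangentVectors φ_smoothAt hc.diffeo.1.mapsTo hb, map_add _ a b⟩
  · rintro ⟨a, ha, b, hb, rfl⟩
    obtain ⟨a', -, rfl⟩ := hN.1.mem_orbitTangent_anchor_iff.1 ha
    obtain ⟨b', rfl⟩ := hc.diffeo.exists_mfderiv_eq_of_mem_tangentVectors hz φ_smoothAt hb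
    exact (hN.2.mem_tangentVectors_iff hS hmS).2 ⟨_, map_add _ a' b'⟩

theorem IsCompatibleVia.isFullSubgroupoidIn_arrowsOf [K.Boundaryless] [IsManifold K ∞ Z]
    (hc : N.IsCompatibleVia I J K S L Lt) (hN : N.IsEquivariantResolution I J K S)
    (hS : IsEmbeddedSubmanifold J S) (hR : Γ.IsLieSubgroupoid I J (N.arrowsOf Lt) L) :
    Γ.IsFullSubgroupoidIn I J (N.arrowsOf Lt) L S where
  isSubgroupoidIn :=
    { isLieSubgroupoid := hR
      dense := hc.dense
      transverse := fun _ hm _ => hc.mem_tangentVectors_iff hN hS hm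
      meets := fun m hm => by
        obtain ⟨z, -, rfl⟩ := hN.2.2.2.1.surjOn hm
        obtain ⟨g, hzg, hact⟩ := hc.meets z hm
        exact ⟨g, hzg.symm, N.anchor_act z g hzg ▸ hc.diffeo.1.mapsTo hact⟩ }
  full g hsrc htgt := by
    obtain ⟨z, hz, hzg⟩ := hc.diffeo.1.surjOn hsrc.1
    obtain ⟨y, hy, hyg⟩ := hc.diffeo.1.surjOn htgt.1
    have act_anchor := N.anchor_act z g hzg
    have act_eq : N.act z g = y := hN.2.2.2.1.injOn (by simpa only [mem_preimage, act_anchor]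
      using htgt.2) (by simpa only [mem_preimage, hyg] using htgt.2) (act_anchor.trans hyg.symm)
    exact ⟨z, hz, hzg, act_eq ▸ hy⟩

theorem IsSmooth.hat (hN : N.IsSmooth I J K) :
    N.hat.IsSmooth (I.prod (K.prod K)) (J.prod K) (K.prod K) where
  anchor := hN.anchor.prodMap contMDiff_id
  act := (hN.act.comp (f := fun q : (Z × Z) × (G × (Z × Z)) => (q.1.1, q.2.1))
    (contMDiff_fst.fst.prodMk contMDiff_snd.fst).contMDiffOn
    fun q (hq : (N.anchor q.1.1, q.1.2) = (Γ.src q.2.1, q.2.2.1)) => (Prod.ext_iff.1 hq).1).prodMk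
    contMDiff_snd.snd.snd.contMDiffOn

theorem IsEquivariantResolution.hat (hN : N.IsEquivariantResolution I J K S) :
    N.hat.IsEquivariantResolution (I.prod (K.prod K)) (J.prod K) (K.prod K) (S ×ˢ univ) :=
  ⟨hN.1.hat, hN.2.prodMap_id⟩

theorem IsEquivariantResolution.isCompatibleVia_diagonal [J.Boundaryless] [K.Boundaryless]
    [IsManifold J ∞ M] [IsManifold K ∞ Z] [FiniteDimensional 𝕜 E₂] [FiniteDimensional 𝕜 E₃]
    (hN : N.IsEquivariantResolution I J K S) :
    N.hat.IsCompatibleVia (I.prod (K.prod K)) (J.prod K) (K.prod K) (S ×ˢ univ)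
      (range fun z => (N.anchor z, z)) (diagonal Z) where
  submanifold := isEmbeddedSubmanifold_graph hN.1.anchor
  dense := N.dense_graph_inter hN.1.anchor.continuous hN.2.2.1
  submanifold_lift := isEmbeddedSubmanifold_diagonal
  diffeo := isDiffeoOn_of_leftInvOn N.hat_bijOn_diagonal hN.hat.1.anchor.contMDiffOn
    (g := fun p => (p.2, p.2)) (fun _ hz => Prod.ext (mem_diagonal_iff.1 hz).symm rfl)
    (contMDiff_snd.prodMk contMDiff_snd).contMDiffOn
  transverse := by
    rintro ⟨z, w⟩ (rfl : z = w) ⟨v₁, v₂⟩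
    exact ⟨_, N.prodMk_zero_mem_orbitTangent_hat z z (v₂ - v₁), _,
      prodMk_self_mem_tangentVectors_diagonal z v₁,
      Prod.ext (zero_add _).symm (sub_add_cancel _ _).symm⟩
  meets := fun w _ =>
    ⟨(Γ.unit (N.anchor w.1), (w.2, w.1)), Prod.ext (Γ.src_unit _).symm rfl, N.act_unit w.1⟩

theorem IsSmooth.locallyExtends_act [I.Boundaryless] (hΓ : Γ.IsLie I J) (hN : N.IsSmooth I J K) :
    LocallyExtends (K.prod I) K (fun p : Z × G => N.act p.1 p.2)
      {p | N.anchor p.1 = Γ.src p.2} := by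
  rintro ⟨z₀, g₀⟩ (h₀ : N.anchor z₀ = Γ.src g₀)
  have src_submersionAt := hΓ.src.isSubmersionAt g₀
  have graph_smooth : ContMDiff (K.prod I) (J.prod I) ∞ fun p : Z × G => (N.anchor p.1, p.2) :=
    hN.anchor.prodMap contMDiff_id
  refine ⟨_, (isOpen_retractionDomain src_submersionAt).preimage graph_smooth.continuous, ?_,
    fun p => N.act p.1 (fibreRetraction src_submersionAt (N.anchor p.1, p.2)), ?_, ?_⟩
  · rw [mem_preimage, h₀]
    exact mem_retractionDomain_self src_submersionAt
  · exact hN.act.comp (contMDiff_fst.contMDiffOn.prodMk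
      ((contMDiffOn_fibreRetraction src_submersionAt).comp graph_smooth.contMDiffOn
        fun _ hp => hp)) fun _ hp => (apply_fibreRetraction src_submersionAt hp).symm
  · rintro ⟨z, g⟩ ⟨hzg, h : N.anchor z = Γ.src g⟩
    simp only [mem_preimage, h] at hzg ⊢
    rw [fibreRetraction_self src_submersionAt hzg]

theorem IsSmooth.isSubmersionOnto_act [I.Boundaryless] (hΓ : Γ.IsLie I J)
    (hN : N.IsSmooth I J K) :
    IsSubmersionOnto (K.prod I) K {p : Z × G | N.anchor p.1 = Γ.src p.2}
      (fun p => N.act p.1 p.2) where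
  surjOn z _ := ⟨(z, Γ.unit (N.anchor z)), (Γ.src_unit _).symm, N.act_unit z⟩
  smooth := hN.locallyExtends_act hΓ
  sections := by
    rintro ⟨z, g⟩ (h : N.anchor z = Γ.src g)
    obtain ⟨V, hV, hgV, τ, hτ, hτg, tgt_τ⟩ :=
      exists_section_of_isSubmersionAt (hΓ.tgt.isSubmersionAt g)
    have anchor_mem : ∀ w ∈ N.anchor ⁻¹' V, N.anchor w = Γ.tgt (τ (N.anchor w)) :=
      fun w hw => (tgt_τ _ hw).symm
    have τ_smooth : ContMDiffOn K I ∞ (fun w => τ (N.anchor w)) (N.anchor ⁻¹' V) :=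
      hτ.comp hN.anchor.contMDiffOn fun _ hw => hw
    have anchor_act := N.anchor_act z g h
    refine ⟨N.anchor ⁻¹' V, hV.preimage hN.anchor.continuous, by rwa [mem_preimage, anchor_act],
      fun w => (N.act w (Γ.inv (τ (N.anchor w))), τ (N.anchor w)), ?_, ?_, fun w hw =>
      ⟨N.anchor_act_inv (anchor_mem w hw), N.act_inv_act (anchor_mem w hw)⟩⟩
    · exact (hN.act.comp (contMDiffOn_id.prodMk (hΓ.inv.comp_contMDiffOn τ_smooth))
        fun w hw => (anchor_mem w hw).trans (Γ.src_inv _).symm).prodMk τ_smooth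
    · simp only [anchor_act, hτg, N.act_act_inv h]

theorem IsSmooth.isEmbeddedSubmanifold_arrowsOf_diagonal [I.Boundaryless] [J.Boundaryless]
    [K.Boundaryless] [IsManifold I ∞ G] [IsManifold J ∞ M] [IsManifold K ∞ Z]
    [FiniteDimensional 𝕜 E₂] [FiniteDimensional 𝕜 E₃] (hΓ : Γ.IsLie I J)
    (hN : N.IsSmooth I J K) :
    IsEmbeddedSubmanifold (I.prod (K.prod K)) (N.hat.arrowsOf (diagonal Z)) := by
  have arrows_eq : N.hat.arrowsOf (diagonal Z) =
      arrowRegrouping I K G Z ⁻¹'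
        {p | p.1 ∈ {q | N.anchor q.1 = Γ.src q.2} ∧ p.2 = N.act p.1.1 p.1.2} :=
    ext fun _ => N.mem_arrowsOf_diagonal
  rw [arrows_eq]
  exact ((isEmbeddedSubmanifold_fibreProduct hN.anchor hΓ.src).graphOn
    (hN.locallyExtends_act hΓ)).preimage_diffeomorph (arrowRegrouping I K G Z)

/-- A path in the graph of the anchor is lifted by lifting its first component along `src` and
letting the lift act on the second. -/
theorem IsSmooth.exists_tangent_arrowsOf_diagonal [I.Boundaryless] (hΓ : Γ.IsLie I J)
    (hN : N.IsSmooth I J K) {r : G × (Z × Z)} (hr : r ∈ N.hat.arrowsOf (diagonal Z)) {v : E₂ × E₃}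
    (hv : v ∈ tangentVectors (J.prod K) (range fun z => (N.anchor z, z))
      ((Γ.prod (pair Z)).src r)) :
    ∃ u ∈ tangentVectors (I.prod (K.prod K)) (N.hat.arrowsOf (diagonal Z)) r,
      mfderiv (I.prod (K.prod K)) (J.prod K) (Γ.prod (pair Z)).src r u = v := by
  obtain ⟨c, hc₀, hc, hcL, rfl⟩ := hv
  obtain ⟨g, z, y⟩ := r
  obtain ⟨-, rfl : y = N.act z g⟩ := N.mem_arrowsOf_diagonal.1 hr
  change c 0 = (Γ.src g, z) at hc₀
  obtain ⟨V, hV, hgV, σ, hσ, hσg, src_σ⟩ :=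
    exists_section_of_isSubmersionAt (hΓ.src.isSubmersionAt g)
  have hc_fst : ContMDiffAt 𝓘(𝕜, 𝕜) J ∞ (fun τ => (c τ).1) 0 := contMDiffAt_fst.comp _ hc
  have hc_snd : ContMDiffAt 𝓘(𝕜, 𝕜) K ∞ (fun τ => (c τ).2) 0 := contMDiffAt_snd.comp _ hc
  have hcV : ∀ᶠ τ in 𝓝 (0 : 𝕜), (c τ).1 ∈ V :=
    hc_fst.continuousAt.preimage_mem_nhds (hV.mem_nhds (by rwa [hc₀]))
  let γ : 𝕜 → G := fun τ => σ (c τ).1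
  have hγ : ContMDiffAt 𝓘(𝕜, 𝕜) I ∞ γ 0 := contMDiffAt_comp_path hσ hc_fst hcV
  have composable : ∀ᶠ τ in 𝓝 (0 : 𝕜), N.anchor (c τ).2 = Γ.src (γ τ) := by
    filter_upwards [hcV, hcL] with τ hτV hτL
    exact (N.mem_range_graph.1 hτL).trans (src_σ _ hτV).symm
  let ρ : 𝕜 → G × (Z × Z) := fun τ => (γ τ, ((c τ).2, N.act (c τ).2 (γ τ)))
  have hρ : ContMDiffAt 𝓘(𝕜, 𝕜) (I.prod (K.prod K)) ∞ ρ 0 :=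
    hγ.prodMk (hc_snd.prodMk (contMDiffAt_comp_path hN.act (hc_snd.prodMk hγ) composable))
  have hρ₀ : ρ 0 = (g, (z, N.act z g)) := by simp only [ρ, γ, hc₀, hσg]
  have src_smooth : ContMDiff (I.prod (K.prod K)) (J.prod K) ∞ (Γ.prod (pair Z)).src :=
    hΓ.src.contMDiff.prodMap contMDiff_fst
  refine ⟨_, ⟨ρ, hρ₀, hρ, composable.mono fun τ hτ => N.mem_arrowsOf_diagonal.2 ⟨hτ, rfl⟩, rfl⟩, ?_⟩
  refine (velocity_comp hρ₀ (src_smooth.mdifferentiable (by simp) _) hρ).symm.trans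
    (velocity_congr (hcV.mono fun τ hτ => ?_))
  exact Prod.ext (src_σ _ hτ) rfl

theorem IsSmooth.isLieSubgroupoid_arrowsOf_diagonal [I.Boundaryless] [J.Boundaryless]
    [K.Boundaryless] [IsManifold I ∞ G] [IsManifold J ∞ M] [IsManifold K ∞ Z]
    [FiniteDimensional 𝕜 E₂] [FiniteDimensional 𝕜 E₃] (hΓ : Γ.IsLie I J)
    (hN : N.IsSmooth I J K) :
    (Γ.prod (pair Z)).IsLieSubgroupoid (I.prod (K.prod K)) (J.prod K)
      (N.hat.arrowsOf (diagonal Z)) (range fun z => (N.anchor z, z)) where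
  objects := isEmbeddedSubmanifold_graph hN.anchor
  arrows := hN.isEmbeddedSubmanifold_arrowsOf_diagonal hΓ
  src_mem _ hr := N.hat_bijOn_diagonal.image_eq ▸ N.hat.src_mem_of_mem_arrowsOf hr
  tgt_mem _ hr := N.hat_bijOn_diagonal.image_eq ▸ N.hat.tgt_mem_of_mem_arrowsOf hr
  unit_mem := by
    rintro _ ⟨z, rfl⟩
    exact N.hat.unit_mem_arrowsOf (mem_diagonal z)
  inv_mem _ := N.hat.inv_mem_arrowsOf
  mul_mem _ hr _ hr' := N.hat.mul_mem_arrowsOf N.hat_bijOn_diagonal.injOn hr hr'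
  submersion _ hr _ := hN.exists_tangent_arrowsOf_diagonal hΓ hr

theorem IsSmooth.isClosed_arrowsOf_diagonal [T2Space M] [T2Space Z] (hs : Continuous Γ.src)
    (hN : N.IsSmooth I J K) : IsClosed (N.hat.arrowsOf (diagonal Z)) := by
  have continuous_anchor := hN.anchor.continuous
  let P : Set (G × (Z × Z)) := {r | N.anchor r.2.1 = Γ.src r.1}
  have hP : IsClosed P := isClosed_eq (by fun_prop) (by fun_prop)
  have act_continuousOn : ContinuousOn (fun r : G × (Z × Z) => (r.2.2, N.act r.2.1 r.1)) P :=
    ContinuousOn.prodMk (by fun_prop) (hN.act.continuousOn.comp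
      (f := fun r : G × (Z × Z) => (r.2.1, r.1)) (by fun_prop) fun _ hr => hr)
  have arrows_eq : N.hat.arrowsOf (diagonal Z) =
      P ∩ (fun r => (r.2.2, N.act r.2.1 r.1)) ⁻¹' diagonal Z :=
    ext fun _ => N.mem_arrowsOf_diagonal
  rw [arrows_eq]
  exact act_continuousOn.preimage_isClosed_of_isClosed hP isClosed_diagonal

theorem IsSmooth.isClosedIn_arrowsOf_diagonal [T2Space M] [T2Space Z] (hs : Continuous Γ.src)
    (hN : N.IsSmooth I J K) :
    (Γ.prod (pair Z)).IsClosedIn (N.hat.arrowsOf (diagonal Z))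
      (range fun z => (N.anchor z, z)) := by
  refine ⟨_, hN.isClosed_arrowsOf_diagonal hs, (inter_eq_left.2 fun r hr => ?_).symm⟩
  rw [← N.hat_bijOn_diagonal.image_eq]
  exact ⟨N.hat.src_mem_of_mem_arrowsOf hr, N.hat.tgt_mem_of_mem_arrowsOf hr⟩

end Smooth

end RightModule

end SetGroupoid

/-! ## The three quotients -/

namespace SetGroupoid

section Algebra

variable {G M Z : Type*} {Γ : SetGroupoid G M}

theorem RightModule.act_eq_act_iff (N : Γ.RightModule Z) {z z' : Z} {γ γ' : G}
    (hz : N.anchor z = Γ.src γ) (hz' : N.anchor z' = Γ.src γ') :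
    N.act z γ = N.act z' γ' ↔
      ∃ g, Γ.tgt g = N.anchor z ∧ z' = N.act z (Γ.inv g) ∧ γ' = Γ.mul g γ := by
  constructor
  · intro h
    have tgt_eq : Γ.tgt γ' = Γ.tgt γ := by
      rw [← N.anchor_act _ _ hz, ← N.anchor_act _ _ hz', h]
    have composable : Γ.tgt γ' = Γ.src (Γ.inv γ) := tgt_eq.trans (Γ.src_inv γ).symm
    refine ⟨Γ.mul γ' (Γ.inv γ), ?_, ?_, (Γ.inv_mul_cancel_right tgt_eq).symm⟩
    · rw [Γ.tgt_mul _ _ composable, Γ.tgt_inv, hz]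
    · rw [Γ.inv_mul_rev composable, Γ.inv_inv,
        N.act_mul _ _ _ hz (tgt_eq.symm.trans (Γ.src_inv γ').symm), h, N.act_act_inv hz']
  · rintro ⟨g, hg, rfl, rfl⟩
    have composable : Γ.tgt g = Γ.src γ := hg.trans hz
    rw [N.act_mul _ _ _ (N.anchor_act_inv hg.symm) composable, N.act_inv_act hg.symm]

namespace Bimodule

variable {G' M' X : Type*} {Γ' : SetGroupoid G' M'} (B : Bimodule Γ Γ' X) (N : Γ.RightModule Z)

theorem act_mem_fibre (q : B.fibre N) {g : G'} (h : B.right.anchor q.1.2 = Γ'.src g) :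
    (q.1.1, B.right.act q.1.2 g) ∈ B.fibre N :=
  Eq.trans (b := B.left.anchor q.1.2) q.2 (B.left_act_right _ _ h).symm

theorem induced_act_mk (q : B.fibre N) {g : G'} (h : B.right.anchor q.1.2 = Γ'.src g) :
    (B.induced N).act (Quot.mk _ q) g =
      Quot.mk _ ⟨(q.1.1, B.right.act q.1.2 g), B.act_mem_fibre N q h⟩ := by
  simp only [induced, h, dif_pos]

end Bimodule

theorem mul_mem_preimage_src {L : Set M} (a : Γ.src ⁻¹' L) {g : G} (h : Γ.tgt a.1 = Γ.src g) :
    Γ.mul a.1 g ∈ Γ.src ⁻¹' L := by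
  rw [mem_preimage, Γ.src_mul _ _ h]
  exact a.2

theorem zModule_act_mk (R : Set G) (L : Set M) (a : Γ.src ⁻¹' L) {g : G}
    (h : Γ.tgt a.1 = Γ.src g) :
    (Γ.ZModule R L).act (Quot.mk _ a) g = Quot.mk _ ⟨Γ.mul a.1 g, mul_mem_preimage_src a h⟩ := by
  simp only [ZModule, h, dif_pos]

variable (N : Γ.RightModule Z)

theorem naturalBimodule_rel_iff (a b : (Γ.naturalBimodule Z).fibre N) :
    (Γ.naturalBimodule Z).rel N a b ↔
      (N.act a.1.1 a.1.2.1, a.1.2.2) = (N.act b.1.1 b.1.2.1, b.1.2.2) := by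
  obtain ⟨⟨z, γ, y⟩, ha⟩ := a
  obtain ⟨⟨z', γ', y'⟩, hb⟩ := b
  rw [Prod.mk_inj, N.act_eq_act_iff ha hb]
  constructor
  · rintro ⟨g, hg, e⟩
    obtain ⟨hz, hγy⟩ := Prod.ext_iff.1 e
    obtain ⟨hγ, hy⟩ := Prod.ext_iff.1 hγy
    exact ⟨⟨g, hg, hz, hγ⟩, hy.symm⟩
  · rintro ⟨⟨g, hg, hz, hγ⟩, hy⟩
    exact ⟨g, hg, Prod.ext hz (Prod.ext hγ hy.symm)⟩

theorem subRel_arrowsOf_diagonal_iff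
    (a b : (Γ.prod (pair Z)).src ⁻¹' range fun z => (N.anchor z, z)) :
    (Γ.prod (pair Z)).subRel (N.hat.arrowsOf (diagonal Z)) _ a b ↔
      (N.act a.1.2.1 a.1.1, a.1.2.2) = (N.act b.1.2.1 b.1.1, b.1.2.2) := by
  obtain ⟨⟨γ, z, y⟩, ha⟩ := a
  obtain ⟨⟨γ', z', y'⟩, hb⟩ := b
  have hz : N.anchor z = Γ.src γ := N.mem_range_graph.1 ha
  have hz' : N.anchor z' = Γ.src γ' := N.mem_range_graph.1 hb
  rw [Prod.mk_inj, N.act_eq_act_iff hz hz']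
  constructor
  · rintro ⟨⟨g, x, x'⟩, hr, htgt, e⟩
    obtain ⟨hx : N.anchor x = Γ.src g, rfl : x' = N.act x g⟩ := N.mem_arrowsOf_diagonal.1 hr
    obtain ⟨hg : Γ.tgt g = Γ.src γ, rfl : N.act x g = z⟩ := Prod.ext_iff.1 htgt
    obtain ⟨hγ, hzy⟩ := Prod.ext_iff.1 e
    obtain ⟨rfl : z' = x, hy⟩ := Prod.ext_iff.1 hzy
    exact ⟨⟨g, hg.trans hz.symm, (N.act_act_inv hx).symm, hγ⟩, hy.symm⟩
  · rintro ⟨⟨g, hg, rfl, rfl⟩, rfl⟩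
    exact ⟨(g, (_, z)), N.mem_arrowsOf_diagonal.2
      ⟨N.anchor_act_inv hg.symm, (N.act_inv_act hg.symm).symm⟩, Prod.ext (hg.trans hz) rfl, rfl⟩

section Inverse

variable {N} {W : Type*} {N' : (Γ.prod (pair Z)).RightModule W} {ψ : W → Z × Z}

theorem mem_naturalBimodule_inverse_fibre_iff
    (anchor_ψ : ∀ u, N.hat.anchor (ψ u) = N'.anchor u) {p : W × (G × Z)} :
    p ∈ (Γ.naturalBimodule Z).inverse.fibre N' ↔
      N.anchor (ψ p.1).1 = Γ.src (Γ.inv p.2.1) ∧ (ψ p.1).2 = p.2.2 := by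
  rw [Γ.src_inv]
  exact (Eq.congr_left (anchor_ψ p.1).symm).trans Prod.ext_iff

theorem naturalBimodule_inverse_rel_iff (injective_ψ : Function.Injective ψ)
    (anchor_ψ : ∀ u, N.hat.anchor (ψ u) = N'.anchor u)
    (ψ_act : ∀ u g, N'.anchor u = (Γ.prod (pair Z)).src g →
      ψ (N'.act u g) = N.hat.act (ψ u) g)
    (a b : (Γ.naturalBimodule Z).inverse.fibre N') :
    (Γ.naturalBimodule Z).inverse.rel N' a b ↔
      N.act (ψ a.1.1).1 (Γ.inv a.1.2.1) = N.act (ψ b.1.1).1 (Γ.inv b.1.2.1) := by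
  obtain ⟨⟨u, γ, z⟩, ha⟩ := a
  obtain ⟨⟨u', γ', z'⟩, hb⟩ := b
  obtain ⟨hu, hz⟩ := (mem_naturalBimodule_inverse_fibre_iff anchor_ψ).1 ha
  obtain ⟨hu', hz'⟩ := (mem_naturalBimodule_inverse_fibre_iff anchor_ψ).1 hb
  have ψ_act_inv (r : G × (Z × Z)) (hr : (Γ.prod (pair Z)).tgt r = N'.anchor u) :
      ψ (N'.act u ((Γ.prod (pair Z)).inv r)) = (N.act (ψ u).1 (Γ.inv r.1), r.2.1) :=
    ψ_act u _ (hr.symm.trans ((Γ.prod (pair Z)).src_inv r).symm)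
  rw [N.act_eq_act_iff hu hu']
  constructor
  · rintro ⟨⟨g, y, y'⟩, hr, e⟩
    obtain ⟨rfl : u' = _, hγz⟩ := Prod.ext_iff.1 e
    obtain ⟨rfl : γ' = Γ.mul γ (Γ.inv g), -⟩ := Prod.ext_iff.1 hγz
    have hg : Γ.tgt g = N.anchor (ψ u).1 := (Prod.ext_iff.1 (hr.trans (anchor_ψ u).symm)).1
    have composable : Γ.tgt γ = Γ.src (Γ.inv g) := by
      rw [Γ.src_inv, hg, hu, Γ.src_inv]
    exact ⟨g, hg, congrArg Prod.fst (ψ_act_inv _ hr), by rw [Γ.inv_mul_rev composable, Γ.inv_inv]⟩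
  · rintro ⟨g, hg, hψ, hγ⟩
    have hr : (Γ.prod (pair Z)).tgt (g, (z', z)) = N'.anchor u :=
      (Prod.ext hg hz.symm).trans (anchor_ψ u)
    have γ'_eq : γ' = Γ.mul γ (Γ.inv g) := by
      rw [← Γ.inv_inv γ', hγ, Γ.inv_mul_rev (hg.trans hu), Γ.inv_inv]
    exact ⟨(g, (z', z)), hr, Prod.ext
      (injective_ψ ((Prod.ext hψ hz').trans (ψ_act_inv _ hr).symm)) (Prod.ext γ'_eq rfl)⟩

end Inverse

end Algebra

section QuotientModule

variable {𝕜 : Type*} [RCLike 𝕜]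
  {E H X : Type*} [NormedAddCommGroup E] [NormedSpace 𝕜 E] [TopologicalSpace H]
  [TopologicalSpace X] [ChartedSpace H X]
  {E₃ H₃ Z : Type*} [NormedAddCommGroup E₃] [NormedSpace 𝕜 E₃] [TopologicalSpace H₃]
  [TopologicalSpace Z] [ChartedSpace H₃ Z]
  {I : ModelWithCorners 𝕜 E H} {K : ModelWithCorners 𝕜 E₃ H₃}
  {G M : Type*} {Γ : SetGroupoid G M}

theorem RightModule.exists_isQuotientManifold_coincide
    [IsManifold K ∞ Z] [T2Space Z] [SecondCountableTopology Z]
    {P : Set X} {q : X → Z} {r : P → P → Prop} (hq : IsSubmersionOnto I K P q)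
    (hr : ∀ a b : P, r a b ↔ q a = q b) (N : Γ.RightModule Z) (N' : Γ.RightModule (Quot r))
    (anchor_q : ∀ x : P, N.anchor (q x) = N'.anchor (Quot.mk r x))
    (act_q : ∀ (x : P) (g : G), N'.anchor (Quot.mk r x) = Γ.src g →
      ∃ y : P, N'.act (Quot.mk r x) g = Quot.mk r y ∧ q y = N.act (q x) g) :
    ∃ _ : ChartedSpace H₃ (Quot r), IsQuotientManifold I K P r ∧ N'.Coincide K N K := by
  obtain ⟨C, hC, Φ, hΦ⟩ := hq.exists_isQuotientManifold hr
  refine ⟨C, hC, Φ, ?_, ?_⟩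
  · rintro ⟨x⟩
    rw [hΦ, anchor_q]
  · rintro ⟨x⟩ g hg
    obtain ⟨y, act_eq, q_y⟩ := act_q x g hg
    rw [act_eq, hΦ, hΦ, q_y]

end QuotientModule

section Smooth

variable {𝕜 : Type*} [RCLike 𝕜]
  {E₁ H₁ G : Type*} [NormedAddCommGroup E₁] [NormedSpace 𝕜 E₁] [TopologicalSpace H₁]
  [TopologicalSpace G] [ChartedSpace H₁ G]
  {E₂ H₂ M : Type*} [NormedAddCommGroup E₂] [NormedSpace 𝕜 E₂] [TopologicalSpace H₂]
  [TopologicalSpace M] [ChartedSpace H₂ M]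
  {E₃ H₃ Z : Type*} [NormedAddCommGroup E₃] [NormedSpace 𝕜 E₃] [TopologicalSpace H₃]
  [TopologicalSpace Z] [ChartedSpace H₃ Z]
  {E₄ H₄ W : Type*} [NormedAddCommGroup E₄] [NormedSpace 𝕜 E₄] [TopologicalSpace H₄]
  [TopologicalSpace W] [ChartedSpace H₄ W]
  {I : ModelWithCorners 𝕜 E₁ H₁} {J : ModelWithCorners 𝕜 E₂ H₂} {K : ModelWithCorners 𝕜 E₃ H₃}
  {K' : ModelWithCorners 𝕜 E₄ H₄} {Γ : SetGroupoid G M} {N : Γ.RightModule Z}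

theorem RightModule.Coincide.isEquivariantResolution {S : Set M} {N' : Γ.RightModule W}
    (h : N'.Coincide K' N K) (hN : N.IsEquivariantResolution I J K S) :
    N'.IsEquivariantResolution I J K' S := by
  obtain ⟨Φ, anchor_Φ, Φ_act⟩ := h
  have anchor_eq : N'.anchor = N.anchor ∘ Φ := funext fun w => (anchor_Φ w).symm
  refine ⟨⟨anchor_eq ▸ hN.1.anchor.comp Φ.contMDiff, ?_⟩, anchor_eq ▸ hN.2.comp_diffeomorph Φ⟩
  have conjugate_smooth : ContMDiffOn (K'.prod I) K' ∞
      (fun q : W × G => Φ.symm (N.act (Φ q.1) q.2)) {q | N'.anchor q.1 = Γ.src q.2} :=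
    Φ.symm.contMDiff.comp_contMDiffOn <| hN.1.act.comp
      (Φ.contMDiff.prodMap contMDiff_id).contMDiffOn fun q hq => (anchor_Φ q.1).trans hq
  exact conjugate_smooth.congr fun q hq => by rw [← Φ_act _ _ hq, Φ.symm_apply_apply]

variable (G Z I K) in
/-- The rearrangement `(z, (γ, y)) ↦ ((z, γ), y)`, which turns an element of the fibre product of
`Z` and the natural bimodule into an argument of the action of `Γ` on `Z` and a spectator in `Z`. -/
def fibreRegrouping :
    Diffeomorph (K.prod (I.prod K)) ((K.prod I).prod K) (Z × (G × Z)) ((Z × G) × Z) ∞ where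
  toEquiv := (Equiv.prodAssoc Z G Z).symm
  contMDiff_toFun := (contMDiff_fst.prodMk contMDiff_snd.fst).prodMk contMDiff_snd.snd
  contMDiff_invFun := contMDiff_fst.fst.prodMk (contMDiff_fst.snd.prodMk contMDiff_snd)

/-- The rearrangement `(u, (γ, z)) ↦ ((z₁, γ⁻¹), (z₂, z))`, where `Ψ u = (z₁, z₂)`. It turns an
element of the fibre product of a copy `W` of `Z × Z` and the inverse natural bimodule into an
argument of the action of `Γ` on `Z` and a point of the diagonal. -/
def inverseRegrouping (hΓ : Γ.IsLie I J) (Ψ : Diffeomorph K' (K.prod K) W (Z × Z) ∞) :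
    Diffeomorph (K'.prod (I.prod K)) ((K.prod I).prod (K.prod K)) (W × (G × Z))
      ((Z × G) × (Z × Z)) ∞ where
  toEquiv := (Ψ.toEquiv.prodCongr
    ((Function.Involutive.toPerm Γ.inv Γ.inv_inv).prodCongr (Equiv.refl Z))).trans
      (Equiv.prodProdProdComm Z Z G Z)
  contMDiff_toFun :=
    have smooth_Ψ := Ψ.contMDiff.comp (contMDiff_fst (I := K') (J := I.prod K) (N := G × Z))
    (smooth_Ψ.fst.prodMk (hΓ.inv.comp contMDiff_snd.fst)).prodMk
      (smooth_Ψ.snd.prodMk contMDiff_snd.snd)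
  contMDiff_invFun :=
    (Ψ.symm.contMDiff.comp (contMDiff_fst.fst.prodMk contMDiff_snd.fst)).prodMk
      ((hΓ.inv.comp contMDiff_fst.snd).prodMk contMDiff_snd.snd)

section Submersions

variable [I.Boundaryless]

theorem RightModule.IsSmooth.isSubmersionOnto_naturalBimodule_fibre (hN : N.IsSmooth I J K)
    (hΓ : Γ.IsLie I J) :
    IsSubmersionOnto (K.prod (I.prod K)) (K.prod K) ((Γ.naturalBimodule Z).fibre N)
      fun p => (N.act p.1 p.2.1, p.2.2) := by
  have fibre_eq : (Γ.naturalBimodule Z).fibre N = fibreRegrouping G Z I K ⁻¹'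
      ({p : Z × G | N.anchor p.1 = Γ.src p.2} ×ˢ univ) := ext fun _ => (and_iff_left trivial).symm
  exact fibre_eq ▸ (hN.isSubmersionOnto_act hΓ).prodMap_id.comp_diffeomorph _

theorem RightModule.IsSmooth.isSubmersionOnto_preimage_src_graph (hN : N.IsSmooth I J K)
    (hΓ : Γ.IsLie I J) :
    IsSubmersionOnto (I.prod (K.prod K)) (K.prod K)
      ((Γ.prod (pair Z)).src ⁻¹' range fun z => (N.anchor z, z))
      fun p => (N.act p.2.1 p.1, p.2.2) := by
  have preimage_eq : ((Γ.prod (pair Z)).src ⁻¹' range fun z => (N.anchor z, z)) =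
      arrowRegrouping I K G Z ⁻¹' ({p : Z × G | N.anchor p.1 = Γ.src p.2} ×ˢ univ) :=
    ext fun _ => N.mem_range_graph.trans (and_iff_left trivial).symm
  exact preimage_eq ▸ (hN.isSubmersionOnto_act hΓ).prodMap_id.comp_diffeomorph _

theorem RightModule.IsSmooth.isSubmersionOnto_naturalBimodule_inverse_fibre
    (hN : N.IsSmooth I J K) (hΓ : Γ.IsLie I J) {N' : (Γ.prod (pair Z)).RightModule W}
    (Ψ : Diffeomorph K' (K.prod K) W (Z × Z) ∞)
    (anchor_Ψ : ∀ u, N.hat.anchor (Ψ u) = N'.anchor u) :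
    IsSubmersionOnto (K'.prod (I.prod K)) K ((Γ.naturalBimodule Z).inverse.fibre N')
      fun p => N.act (Ψ p.1).1 (Γ.inv p.2.1) := by
  have fibre_eq : (Γ.naturalBimodule Z).inverse.fibre N' = inverseRegrouping hΓ Ψ ⁻¹'
      ({p : Z × G | N.anchor p.1 = Γ.src p.2} ×ˢ diagonal Z) :=
    ext fun _ => mem_naturalBimodule_inverse_fibre_iff anchor_Ψ
  exact fibre_eq ▸ ((hN.isSubmersionOnto_act hΓ).comp_fst
    fun ⟨z⟩ => ⟨(z, z), mem_diagonal z⟩).comp_diffeomorph (inverseRegrouping hΓ Ψ)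

end Submersions

variable [I.Boundaryless] [IsManifold K ∞ Z] [T2Space Z] [SecondCountableTopology Z]

theorem RightModule.IsSmooth.exists_induced_naturalBimodule_coincide (hN : N.IsSmooth I J K)
    (hΓ : Γ.IsLie I J) :
    ∃ _ : ChartedSpace (ModelProd H₃ H₃) ((Γ.naturalBimodule Z).Induced N),
      IsQuotientManifold (K.prod (I.prod K)) (K.prod K) ((Γ.naturalBimodule Z).fibre N)
        ((Γ.naturalBimodule Z).rel N) ∧
      ((Γ.naturalBimodule Z).induced N).Coincide (K.prod K) N.hat (K.prod K) :=
  exists_isQuotientManifold_coincide (hN.isSubmersionOnto_naturalBimodule_fibre hΓ)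
    (naturalBimodule_rel_iff N) N.hat _ (fun p => Prod.ext (N.anchor_act _ _ p.2) rfl)
    fun p _ hg => ⟨_, Bimodule.induced_act_mk _ N p hg,
      Prod.ext (N.act_mul _ _ _ p.2 (Prod.ext_iff.1 hg).1) rfl⟩

theorem RightModule.IsSmooth.exists_zModule_arrowsOf_diagonal_coincide (hN : N.IsSmooth I J K)
    (hΓ : Γ.IsLie I J) :
    ∃ _ : ChartedSpace (ModelProd H₃ H₃) ((Γ.prod (pair Z)).ZQuot (N.hat.arrowsOf (diagonal Z))
        (range fun z => (N.anchor z, z))),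
      IsQuotientManifold (I.prod (K.prod K)) (K.prod K)
        ((Γ.prod (pair Z)).src ⁻¹' range fun z => (N.anchor z, z))
        ((Γ.prod (pair Z)).subRel (N.hat.arrowsOf (diagonal Z))
          (range fun z => (N.anchor z, z))) ∧
      ((Γ.prod (pair Z)).ZModule (N.hat.arrowsOf (diagonal Z))
        (range fun z => (N.anchor z, z))).Coincide (K.prod K) N.hat (K.prod K) :=
  exists_isQuotientManifold_coincide (hN.isSubmersionOnto_preimage_src_graph hΓ)
    (subRel_arrowsOf_diagonal_iff N) N.hat _
    (fun a => Prod.ext (N.anchor_act _ _ (N.mem_range_graph.1 a.2)) rfl)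
    fun a _ hg => ⟨_, zModule_act_mk _ _ a hg,
      Prod.ext (N.act_mul _ _ _ (N.mem_range_graph.1 a.2) (Prod.ext_iff.1 hg).1) rfl⟩

theorem RightModule.IsSmooth.exists_induced_inverse_naturalBimodule_coincide
    (hN : N.IsSmooth I J K) (hΓ : Γ.IsLie I J) {N' : (Γ.prod (pair Z)).RightModule W}
    (h : N'.Coincide K' N.hat (K.prod K)) :
    ∃ _ : ChartedSpace H₃ ((Γ.naturalBimodule Z).inverse.Induced N'),
      IsQuotientManifold (K'.prod (I.prod K)) K ((Γ.naturalBimodule Z).inverse.fibre N')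
        ((Γ.naturalBimodule Z).inverse.rel N') ∧
      ((Γ.naturalBimodule Z).inverse.induced N').Coincide K N K := by
  obtain ⟨Ψ, anchor_Ψ, Ψ_act⟩ := h
  have anchor_eq (p : (Γ.naturalBimodule Z).inverse.fibre N') :
      N.anchor (Ψ p.1.1).1 = Γ.src (Γ.inv p.1.2.1) :=
    ((mem_naturalBimodule_inverse_fibre_iff anchor_Ψ).1 p.2).1
  refine exists_isQuotientManifold_coincide
    (hN.isSubmersionOnto_naturalBimodule_inverse_fibre hΓ Ψ anchor_Ψ)
    (naturalBimodule_inverse_rel_iff Ψ.injective anchor_Ψ Ψ_act) N _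
    (fun p => (N.anchor_act _ _ (anchor_eq p)).trans (Γ.tgt_inv _))
    fun p g hg => ⟨_, Bimodule.induced_act_mk _ N' p hg, ?_⟩
  change Γ.src p.1.2.1 = Γ.src g at hg
  have composable : Γ.tgt (Γ.inv g) = Γ.src p.1.2.1 := (Γ.tgt_inv g).trans hg.symm
  change N.act (Ψ p.1.1).1 (Γ.inv (Γ.mul (Γ.inv g) p.1.2.1)) = _
  rw [Γ.inv_mul_rev composable, Γ.inv_inv,
    N.act_mul _ _ _ (anchor_eq p) ((Γ.tgt_inv _).trans hg)]

end Smooth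

end SetGroupoid

theorem mainTheorem7_general {𝕜 : Type*} [RCLike 𝕜]
    {E₁ H₁ G : Type*} [NormedAddCommGroup E₁] [NormedSpace 𝕜 E₁]
    [TopologicalSpace H₁] (I : ModelWithCorners 𝕜 E₁ H₁) [I.Boundaryless]
    [TopologicalSpace G] [ChartedSpace H₁ G] [IsManifold I ∞ G]
    {E₂ H₂ M : Type*} [NormedAddCommGroup E₂] [NormedSpace 𝕜 E₂] [FiniteDimensional 𝕜 E₂]
    [TopologicalSpace H₂] (J : ModelWithCorners 𝕜 E₂ H₂) [J.Boundaryless]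
    [TopologicalSpace M] [ChartedSpace H₂ M] [IsManifold J ∞ M]
    [T2Space M]
    {E₃ H₃ Z : Type*} [NormedAddCommGroup E₃] [NormedSpace 𝕜 E₃] [FiniteDimensional 𝕜 E₃]
    [TopologicalSpace H₃] (K : ModelWithCorners 𝕜 E₃ H₃) [K.Boundaryless]
    [TopologicalSpace Z] [ChartedSpace H₃ Z] [IsManifold K ∞ Z]
    [T2Space Z] [SecondCountableTopology Z]
    (Γ : SetGroupoid G M) (hΓ : Γ.IsLie I J)
    (S : Set M) (hS : IsEmbeddedSubmanifold J S) (hΓS : Γ.IsStable S) (hS₀ : S.Nonempty)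
    (N : Γ.RightModule Z) (hN : N.IsEquivariantResolution I J K S) :
    let Γh := Γ.prod (SetGroupoid.pair Z)
    let X := Γ.naturalBimodule Z
    let Sh : Set (M × Z) := S ×ˢ Set.univ
    let Nh := N.hat
    let L : Set (M × Z) := Set.range fun z => (N.anchor z, z)
    let R : Set (G × (Z × Z)) := Nh.arrowsOf (Set.diagonal Z)
    let Ih := I.prod (K.prod K)
    let Jh := J.prod K
    let Kh := K.prod K
    Γh.IsLie Ih Jh ∧ X.IsMorita I J Ih Jh (I.prod K) ∧
    X.mapStable S = Sh ∧ IsEmbeddedSubmanifold Jh Sh ∧ Γh.IsStable Sh ∧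
    Nh.IsEquivariantResolution Ih Jh Kh Sh ∧
    (∃ _ : ChartedSpace (ModelProd H₃ H₃) (X.Induced N),
      IsQuotientManifold (K.prod (I.prod K)) Kh (X.fibre N) (X.rel N) ∧
      (X.induced N).Coincide Kh Nh Kh) ∧
    Nh.IsCompatibleVia Ih Jh Kh Sh L (Set.diagonal Z) ∧
    Γh.IsFullSubgroupoidIn Ih Jh R L Sh ∧ Γh.IsClosedIn R L ∧
    ∃ _ : ChartedSpace (ModelProd H₃ H₃) (Γh.ZQuot R L),
      IsQuotientManifold Ih Kh (Γh.src ⁻¹' L) (Γh.subRel R L) ∧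
      (Γh.ZModule R L).IsEquivariantResolution Ih Jh Kh Sh ∧
      (Γh.ZModule R L).Coincide Kh Nh Kh ∧
      ∃ _ : ChartedSpace H₃ (X.inverse.Induced (Γh.ZModule R L)),
        IsQuotientManifold (Kh.prod (I.prod K)) K (X.inverse.fibre (Γh.ZModule R L))
          (X.inverse.rel (Γh.ZModule R L)) ∧
        (X.inverse.induced (Γh.ZModule R L)).IsEquivariantResolution I J K S ∧
        (X.inverse.induced (Γh.ZModule R L)).Coincide K N K := by
  intro Γh X Sh Nh L R Ih Jh Kh
  obtain ⟨x, hx⟩ := hS₀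
  obtain ⟨z, -⟩ := hN.2.2.2.1.surjOn hx
  have : Nonempty Z := ⟨z⟩
  have morita : X.IsMorita I J Ih Jh (I.prod K) := hΓ.naturalBimodule_isMorita (K := K) (Z := Z)
  have hSh : IsEmbeddedSubmanifold Jh Sh := hS.prod_univ
  have hNh : Nh.IsEquivariantResolution Ih Jh Kh Sh := hN.hat
  have compatible : Nh.IsCompatibleVia Ih Jh Kh Sh L (Set.diagonal Z) :=
    hN.isCompatibleVia_diagonal
  have full : Γh.IsFullSubgroupoidIn Ih Jh R L Sh :=
    compatible.isFullSubgroupoidIn_arrowsOf hNh hSh (hN.1.isLieSubgroupoid_arrowsOf_diagonal hΓ)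
  obtain ⟨C, hC, ZR_coincide⟩ := hN.1.exists_zModule_arrowsOf_diagonal_coincide hΓ
  obtain ⟨D, hD, XinvZR_coincide⟩ :=
    hN.1.exists_induced_inverse_naturalBimodule_coincide hΓ ZR_coincide
  exact ⟨hΓ.prod SetGroupoid.isLie_pair, morita, SetGroupoid.naturalBimodule_mapStable Z Γ hΓS,
    hSh, hΓS.prod_univ _, hNh, hN.1.exists_induced_naturalBimodule_coincide hΓ, compatible,
    full, hN.1.isClosedIn_arrowsOf_diagonal hΓ.src.contMDiff.continuous,
    C, hC, ZR_coincide.isEquivariantResolution hNh, ZR_coincide,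
    D, hD, XinvZR_coincide.isEquivariantResolution hN, XinvZR_coincide⟩

theorem mainTheorem7 {𝕜 : Type*} [RCLike 𝕜]
    {E₁ H₁ G : Type*} [NormedAddCommGroup E₁] [NormedSpace 𝕜 E₁] [FiniteDimensional 𝕜 E₁]
    [TopologicalSpace H₁] (I : ModelWithCorners 𝕜 E₁ H₁) [I.Boundaryless]
    [TopologicalSpace G] [ChartedSpace H₁ G] [IsManifold I ∞ G]
    {E₂ H₂ M : Type*} [NormedAddCommGroup E₂] [NormedSpace 𝕜 E₂] [FiniteDimensional 𝕜 E₂]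
    [TopologicalSpace H₂] (J : ModelWithCorners 𝕜 E₂ H₂) [J.Boundaryless]
    [TopologicalSpace M] [ChartedSpace H₂ M] [IsManifold J ∞ M]
    [T2Space M] [SecondCountableTopology M]
    {E₃ H₃ Z : Type*} [NormedAddCommGroup E₃] [NormedSpace 𝕜 E₃] [FiniteDimensional 𝕜 E₃]
    [TopologicalSpace H₃] (K : ModelWithCorners 𝕜 E₃ H₃) [K.Boundaryless]
    [TopologicalSpace Z] [ChartedSpace H₃ Z] [IsManifold K ∞ Z]
    [T2Space Z] [SecondCountableTopology Z]
    -- a Lie groupoid `Γ ⇉ M`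
    (Γ : SetGroupoid G M) (hΓ : Γ.IsLie I J)
    -- a nonempty embedded `Γ`-stable submanifold `S` of `M`
    (S : Set M) (hS : IsEmbeddedSubmanifold J S) (hΓS : Γ.IsStable S) (hS₀ : S.Nonempty)
    -- a `Γ`-resolution `(Z, φ)` of the closure of `S`, where `φ = N.anchor`
    (N : Γ.RightModule Z) (hN : N.IsEquivariantResolution I J K S) :
    -- `Γh` is the product groupoid, `X` the natural bimodule on `Γ × Z`, `Sh = S × Z`,
    -- `Nh` is `(Z × Z, φ × id)`, `L` is the graph of `φ`, and `R` is the set of arrows that the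
    -- diagonal of `Z × Z` determines
    let Γh := Γ.prod (SetGroupoid.pair Z)
    let X := Γ.naturalBimodule Z
    let Sh : Set (M × Z) := S ×ˢ Set.univ
    let Nh := N.hat
    let L : Set (M × Z) := Set.range fun z => (N.anchor z, z)
    let R : Set (G × (Z × Z)) := Nh.arrowsOf (Set.diagonal Z)
    let Ih := I.prod (K.prod K)
    let Jh := J.prod K
    let Kh := K.prod K
    -- `X` is a Morita equivalence of Lie groupoids, which takes `S` to `Sh`
    Γh.IsLie Ih Jh ∧ X.IsMorita I J Ih Jh (I.prod K) ∧
    X.mapStable S = Sh ∧ IsEmbeddedSubmanifold Jh Sh ∧ Γh.IsStable Sh ∧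
    -- `Nh` is a `Γh`-resolution of the closure of `Sh`; it is the one that corresponds to `N`
    -- under `X`
    Nh.IsEquivariantResolution Ih Jh Kh Sh ∧
    (∃ _ : ChartedSpace (ModelProd H₃ H₃) (X.Induced N),
      IsQuotientManifold (K.prod (I.prod K)) Kh (X.fibre N) (X.rel N) ∧
      (X.induced N).Coincide Kh Nh Kh) ∧
    -- the diagonal shows that `Nh` is `L`-compatible
    Nh.IsCompatibleVia Ih Jh Kh Sh L (Set.diagonal Z) ∧
    -- `R ⇉ L` is a closed Lie subgroupoid of `Γh`, full in `Sh`
    Γh.IsFullSubgroupoidIn Ih Jh R L Sh ∧ Γh.IsClosedIn R L ∧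
    -- `Z(R)` is a manifold and a `Γh`-resolution which coincides with `Nh`, and `X⁻¹ (Z(R))` is a
    -- manifold and a right `Γ`-module which coincides with `N`
    ∃ _ : ChartedSpace (ModelProd H₃ H₃) (Γh.ZQuot R L),
      IsQuotientManifold Ih Kh (Γh.src ⁻¹' L) (Γh.subRel R L) ∧
      (Γh.ZModule R L).IsEquivariantResolution Ih Jh Kh Sh ∧
      (Γh.ZModule R L).Coincide Kh Nh Kh ∧
      ∃ _ : ChartedSpace H₃ (X.inverse.Induced (Γh.ZModule R L)),
        IsQuotientManifold (Kh.prod (I.prod K)) K (X.inverse.fibre (Γh.ZModule R L))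
          (X.inverse.rel (Γh.ZModule R L)) ∧
        (X.inverse.induced (Γh.ZModule R L)).IsEquivariantResolution I J K S ∧
        (X.inverse.induced (Γh.ZModule R L)).Coincide K N K :=
  mainTheorem7_general I J K Γ hΓ S hS hΓS hS₀ N hN
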